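/- Let $n\ge 2$, let $\mathbb P^n=\{z\in\mathbb C^n:\ |z_i|<1,\ i=1,\dots,n\}$ and $|z|_\infty=\max_i|z_i|$. For a mapping $f$ write $Df$ for its complex derivative and $J_f=\det Df$ for its complex Jacobian. For a locally biholomorphic mapping $f=(f_1,\dots,f_n):\mathbb P^n\to\mathbb C^n$ and $1\le i,j,k\le n$ put $$S^k_{ij}f=\sum_{l=1}^n\frac{\partial^2 f_l}{\partial z_i\partial z_j}\,\frac{\partial z_k}{\partial f_l}-\frac1{n+1}\Big(\delta^k_i\frac{\partial}{\partial z_j}+\delta^k_j\frac{\partial}{\partial z_i}\Big)\log J_f ,$$ where $\partial z_k/\partial f_l$ is the $(k,l)$ entry of $(Df)^{-1}$, and let $S_f(z)(v)\in\mathbb C^n$ be the vector with $k$-th component $\sum_{i,j}S^k_{ij}f(z)\,v_iv_j$. With the Bergman norm $\|v\|_z=\big(2\sum_i|v_i|^2/(1-|z_i|^2)^2\big)^{1/2}$ at $z\in\mathbb P^n$, let $$\|S_f\|=\sup_{z\in\mathbb P^n}\ \sup_{\|v\|_z=1}\|S_f(z)(v)\|_z\in[0,\infty].$$ For real $\alpha$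 let $\mathcal F_\alpha$ be the family of locally biholomorphic $f:\mathbb P^n\to\mathbb C^n$ with $f(0)=0$, $Df(0)=I$ and $\|S_f\|\le\alpha$. Let $\mathcal F_\alpha^0$ be the family of the mappings $T\circ f$ with $f\in\mathcal F_\alpha$ and $$T(w)=\frac{w}{1+a_1w_1+\cdots+a_nw_n},\qquad (a_1,\dots,a_n)=\frac1{n+1}\nabla J_f(0),$$ which are the normalizations of $f$ for which $\nabla J_{T\circ f}(0)=0$ (a priori they may have poles in $\mathbb P^n$). **Corollary 3.11.** Suppose $n\sqrt n\,\alpha\le \frac1{6.1}$ and $f\in\mathcal F_\alpha^0$. Then $f$ is holomorphic in $\mathbb P^n$, and for all $z\in\mathbb P^n$ $$\left(1-|z|_\infty^2\right)^{\frac{\sqrt n\,(n+1)}2}\le|J_f(z)|\le\frac1{\left(1-|z|_\infty^2\right)^{\frac{\sqrt n\,(n+1)}2}} .$$ -/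

import Mathlib

noncomputable section

/-- The unit polydisk in `ℂⁿ`. -/
def polydisk (n : ℕ) : Set (Fin n → ℂ) := {z | ∀ i, ‖z i‖ < 1}

/-- The complex partial derivative `∂F/∂zⱼ` of a scalar function of `n` complex variables. -/
def partialDeriv {n : ℕ} (j : Fin n) (F : (Fin n → ℂ) → ℂ) (z : Fin n → ℂ) : ℂ :=
  fderiv ℂ F z (Pi.single j 1)

/-- The complex Jacobian matrix `Df(z)`, with entry `∂fᵢ/∂zⱼ` in row `i` and column `j`. -/
def jacobianMatrix {n : ℕ} (f : (Fin n → ℂ) → (Fin n → ℂ)) (z : Fin n → ℂ) :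
    Matrix (Fin n) (Fin n) ℂ :=
  Matrix.of fun i j => partialDeriv j (fun w => f w i) z

/-- The complex Jacobian `J_f(z) = det Df(z)`. -/
def jacobian {n : ℕ} (f : (Fin n → ℂ) → (Fin n → ℂ)) (z : Fin n → ℂ) : ℂ :=
  (jacobianMatrix f z).det

/-- `f` is locally biholomorphic on the open set `Ω`: it is holomorphic there, and every point
of `Ω` has an open neighbourhood in `Ω` that `f` maps injectively onto an open set, with
holomorphic inverse. -/
def IsLocallyBiholomorphicOn {n : ℕ} (f : (Fin n → ℂ) → (Fin n → ℂ))
    (Ω : Set (Fin n → ℂ)) : Prop :=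
  DifferentiableOn ℂ f Ω ∧
    ∀ z ∈ Ω, ∃ U : Set (Fin n → ℂ), IsOpen U ∧ z ∈ U ∧ U ⊆ Ω ∧ IsOpen (f '' U) ∧
      ∃ h : (Fin n → ℂ) → (Fin n → ℂ),
        DifferentiableOn ℂ h (f '' U) ∧ Set.LeftInvOn h f U

/-- The partial derivative `∂(log J_f)/∂zⱼ`. It is written as `(∂J_f/∂zⱼ) / J_f`, which is its
value for every local branch of the logarithm where `J_f ≠ 0`. -/
def partialLogJacobian {n : ℕ} (j : Fin n) (f : (Fin n → ℂ) → (Fin n → ℂ))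
    (z : Fin n → ℂ) : ℂ :=
  partialDeriv j (jacobian f) z / jacobian f z

/-- The Schwarzian derivatives
`S^k_{ij} f = ∑ₗ (∂²fₗ/∂zᵢ∂zⱼ) (∂zₖ/∂fₗ) - (n+1)⁻¹ (δ^k_i ∂ⱼ + δ^k_j ∂ᵢ) log J_f`,
where `∂zₖ/∂fₗ` is the entry of the inverse matrix of `Df(z)` in row `k` and column `l`. -/
def schwarzianDeriv {n : ℕ} (f : (Fin n → ℂ) → (Fin n → ℂ)) (i j k : Fin n)
    (z : Fin n → ℂ) : ℂ :=
  ∑ l, partialDeriv i (partialDeriv j (fun w => f w l)) z * (jacobianMatrix f z)⁻¹ k l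
    - 1 / ((n : ℂ) + 1) *
      ((if k = i then 1 else 0) * partialLogJacobian j f z
        + (if k = j then 1 else 0) * partialLogJacobian i f z)

/-- The Schwarzian derivative operator `S_f(z)`: its `k`-th component at `v` is the quadratic
form `∑ᵢⱼ S^k_{ij} f(z) vᵢ vⱼ`. -/
def schwarzianOp {n : ℕ} (f : (Fin n → ℂ) → (Fin n → ℂ)) (z v : Fin n → ℂ) : Fin n → ℂ :=
  fun k => ∑ i, ∑ j, v i * schwarzianDeriv f i j k z * v j

/-- The Bergman norm of a tangent vector `v` of the polydisk at the point `z`. -/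
def bergmanNorm {n : ℕ} (z v : Fin n → ℂ) : ℝ :=
  Real.sqrt (2 * ∑ i, ‖v i‖ ^ 2 / (1 - ‖z i‖ ^ 2) ^ 2)

/-- The norm `‖S_f(z)‖`, the supremum of the Bergman norm of `S_f(z)(v)` over the vectors `v`
of Bergman norm one at `z`, as an extended real number. -/
def schwarzianNormAt {n : ℕ} (f : (Fin n → ℂ) → (Fin n → ℂ)) (z : Fin n → ℂ) : EReal :=
  ⨆ (v : Fin n → ℂ) (_ : bergmanNorm z v = 1), (bergmanNorm z (schwarzianOp f z v) : EReal)

/-- The norm `‖S_f‖`, the supremum of `‖S_f(z)‖` over the polydisk, as an extended real number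
(it may be infinite). -/
def schwarzianNorm {n : ℕ} (f : (Fin n → ℂ) → (Fin n → ℂ)) : EReal :=
  ⨆ z ∈ polydisk n, schwarzianNormAt f z

/-- The family `𝓕_α`: the locally biholomorphic mappings `f` of the polydisk into `ℂⁿ` with
`f(0) = 0`, `Df(0) = I` and `‖S_f‖ ≤ α`. -/
def schwarzianFamily (n : ℕ) (α : ℝ) : Set ((Fin n → ℂ) → (Fin n → ℂ)) :=
  {f | IsLocallyBiholomorphicOn f (polydisk n) ∧ f 0 = 0 ∧ jacobianMatrix f 0 = 1 ∧
    schwarzianNorm f ≤ (α : EReal)}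

/-- The Möbius transformation `w ↦ w / (1 + a₁w₁ + ⋯ + aₙwₙ)`. On the hyperplane where the
denominator vanishes (the poles) the value in the code is `0`. -/
def moebius {n : ℕ} (a w : Fin n → ℂ) : Fin n → ℂ :=
  fun i => w i / (1 + ∑ j, a j * w j)

/-- The vector `a = ∇J_f(0) / (n+1)`; with it, `g = moebius a ∘ f` has `∇J_g(0) = 0` whenever
`f` is locally biholomorphic with `f(0) = 0` and `Df(0) = I`. -/
def normalizingVector {n : ℕ} (f : (Fin n → ℂ) → (Fin n → ℂ)) : Fin n → ℂ :=
  fun i => partialDeriv i (jacobian f) 0 / ((n : ℂ) + 1)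

/-- The family `𝓕_α⁰` of the normalized mappings `g = T ∘ f` on the polydisk, where `f ∈ 𝓕_α` and
`T` is the Möbius transformation above with `a = ∇J_f(0) / (n+1)`. -/
def normalizedFamily (n : ℕ) (α : ℝ) : Set ((Fin n → ℂ) → (Fin n → ℂ)) :=
  {g | ∃ f ∈ schwarzianFamily n α,
    Set.EqOn g (fun z => moebius (normalizingVector f) (f z)) (polydisk n)}

end

noncomputable section

/-! Let `D = 1 + ∑ aⱼ fⱼ` be the denominator of `T ∘ f`. Then `J_{T∘f} = J_f / D^(n+1)`, so `u =
J_{T∘f}^(-1/(n+1))` is `D · J_f^(-1/(n+1))`. For every affine function `D` of `f` this product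
solves the linear system `u_{ij} = ∑ₖ Sᵏᵢⱼ uₖ + S⁰ᵢⱼ u`, whose coefficients depend only on `f`. The
logarithmic derivatives `qᵢ = ∂ᵢ log u` therefore satisfy the Riccati system `∂ⱼ qᵢ = ∑ₖ Sᵏⱼᵢ qₖ -
qᵢ qⱼ + S⁰ⱼᵢ` (`partialDeriv_logDerivRoot`), and the choice of `a` gives `q(0) = 0`.

The coefficients are controlled as follows. Polarization turns `‖S_f‖ ≤ α` into a weighted bound for
each entry (`norm_schwarzianDeriv_le`). An entry whose upper index differs from both lower ones then
tends to zero at the boundary in the corresponding variable, and so vanishes identically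
(`schwarzianDeriv_eq_zero_of_ne`). Flatness of the connection induced by `f`, contracted once,
writes `(n - 1) S⁰ᵢⱼ` as a quadratic expression in `S` minus a divergence of `S`
(`schwarzianPotential_eq`); one-variable Cauchy and Schwarz-Pick estimates bound the divergence.

On a ray `t ζ` with `|ζᵢ| ≤ 1`, the sum `R = ∑ |ζᵢ qᵢ|` obeys `R' ≤ c R / (1 - t²) + P / (1 - t²)² +
R²`. The hypothesis on `α` makes `c` and `P` small enough for `(9/10) t / (1 - t²)` to be a strict
upper barrier (`exists_coefficient_bounds`, `sum_norm_logDerivRoot_ray_le`). Hence `D' / D` stays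
bounded up to a putative first zero of `D`, so `D` has no zero and `T ∘ f` is holomorphic. As `-(n +
1) ∑ ζᵢ qᵢ` is the logarithmic derivative of `J_{T∘f}` along the ray, integrating the barrier gives
both Jacobian bounds. -/

/-! ### Holomorphy of partial derivatives in several variables. -/

open Metric in
/-- Near a point, the derivative of a holomorphic function of several variables is bounded. -/
lemma exists_ball_norm_fderiv_le {n : ℕ} {F : (Fin n → ℂ) → ℂ} {s : Set (Fin n → ℂ)}
    (hs : IsOpen s) (hF : DifferentiableOn ℂ F s) {x : Fin n → ℂ} (hx : x ∈ s) :
    ∃ δ > 0, ball x (3 * δ) ⊆ s ∧ ∀ p ∈ ball x (2 * δ), ‖fderiv ℂ F p‖ ≤ 2 / δ := by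
  obtain ⟨ε, hε, hεs⟩ := Metric.isOpen_iff.1 hs x hx
  obtain ⟨η, hη, hηF⟩ := Metric.continuousAt_iff.1 (hF.continuousOn.continuousAt (hs.mem_nhds hx))
    1 one_pos
  refine ⟨min ε η / 3, by positivity, fun y hy => hεs (ball_subset_ball ?_ hy), fun p hp => ?_⟩
  · have := min_le_left ε η
    linarith
  · have hsub : ∀ y ∈ ball p (min ε η / 3), dist y x < min ε η := fun y hy => by
      have h1 := dist_triangle y p x
      rw [mem_ball] at hy hp
      linarith
    -- On the ball of radius `min ε η / 3` about `p` every value of `F` is within `1` of `F x`,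
    -- hence within `2` of `F p`; this is the `2` in the bound.
    refine Complex.norm_fderiv_le_div_of_mapsTo_ball (hF.mono fun y hy => hεs ?_) (fun y hy => ?_)
      (by positivity)
    · exact (hsub y hy).trans_le (min_le_left _ _)
    · have h1 := hηF ((hsub y hy).trans_le (min_le_right _ _))
      have h2 := hηF ((hsub p (mem_ball_self (by positivity))).trans_le (min_le_right _ _))
      rw [mem_closedBall]
      have := dist_triangle_right (F y) (F p) (F x)
      linarith

open Metric MeasureTheory in
/-- The partial derivatives of a holomorphic function of several variables are holomorphic. -/
theorem DifferentiableOn.partialDeriv {n : ℕ} {F : (Fin n → ℂ) → ℂ} {s : Set (Fin n → ℂ)}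
    (hF : DifferentiableOn ℂ F s) (hs : IsOpen s) (j : Fin n) :
    DifferentiableOn ℂ (partialDeriv j F) s := by
  intro x hx
  obtain ⟨δ, hδ, hball, hbound⟩ := exists_ball_norm_fderiv_le hs hF hx
  set v : Fin n → ℂ := Pi.single j 1 with hv
  have hv1 : ‖v‖ = 1 := by rw [hv, Pi.norm_single, norm_one]
  have hmem : ∀ y ∈ ball x δ, ∀ ξ : ℂ, ‖ξ‖ ≤ δ → y + ξ • v ∈ ball x (2 * δ) := by
    intro y hy ξ hξ
    rw [mem_ball, dist_eq_norm] at hy ⊢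
    calc ‖y + ξ • v - x‖ = ‖(y - x) + ξ • v‖ := by congr 1; abel
      _ ≤ ‖y - x‖ + ‖ξ • v‖ := norm_add_le _ _
      _ < δ + δ := by rw [norm_smul, hv1, mul_one]; linarith
      _ = 2 * δ := by ring
  have h23 : ball x (2 * δ) ⊆ s := (ball_subset_ball (by linarith)).trans hball
  -- Cauchy's formula for the derivative in the direction `v`: the kernel does not depend on the
  -- base point `y`, so `∂ⱼF` can be differentiated under the integral sign using only the first
  -- derivative of `F`, which is locally bounded.
  set K : ℝ → ℂ := fun θ => _root_.deriv (circleMap 0 δ) θ * ((circleMap 0 δ θ - 0) ^ 2)⁻¹ with hK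
  have hKc : Continuous K := by
    simp only [hK, deriv_circleMap, sub_zero]
    refine ((continuous_circleMap 0 δ).mul continuous_const).mul
      (((continuous_circleMap 0 δ).pow 2).inv₀ fun θ => ?_)
    simpa using hδ.ne'
  have hKn : ∀ θ, ‖K θ‖ = 1 / δ := by
    intro θ
    simp only [hK, deriv_circleMap, sub_zero, norm_mul, norm_inv, norm_pow, norm_circleMap_zero,
      Complex.norm_I, abs_of_pos hδ]
    field_simp
  have hcm : ∀ θ, ‖circleMap 0 δ θ‖ ≤ δ := fun θ => by simp [abs_of_pos hδ]
  have hdiff : ∀ y ∈ ball x δ, ∀ θ, HasFDerivAt (fun y => K θ * F (y + circleMap 0 δ θ • v))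
      (K θ • fderiv ℂ F (y + circleMap 0 δ θ • v)) y := by
    intro y hy θ
    have h1 := (hF.differentiableAt (hs.mem_nhds (h23 (hmem y hy _ (hcm θ))))).hasFDerivAt
    exact (h1.comp y ((hasFDerivAt_id y).add_const (circleMap 0 δ θ • v))).const_mul (K θ)
  have hcont : ∀ y ∈ ball x δ, Continuous fun θ => K θ * F (y + circleMap 0 δ θ • v) := by
    intro y hy
    refine hKc.mul (continuous_iff_continuousAt.2 fun θ => ?_)
    refine ContinuousAt.comp (f := fun θ => y + circleMap 0 δ θ • v) (g := F)
      (hF.differentiableAt (hs.mem_nhds (h23 (hmem y hy _ (hcm θ))))).continuousAt ?_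
    exact (continuous_const.add ((continuous_circleMap 0 δ).smul continuous_const)).continuousAt
  have key := intervalIntegral.hasFDerivAt_integral_of_dominated_of_fderiv_le (𝕜 := ℂ)
    (μ := volume) (a := 0) (b := 2 * Real.pi) (s := ball x δ) (x₀ := x)
    (F := fun y θ => K θ * F (y + circleMap 0 δ θ • v))
    (F' := fun y θ => K θ • fderiv ℂ F (y + circleMap 0 δ θ • v))
    (bound := fun _ => 1 / δ * (2 / δ)) (ball_mem_nhds x hδ)
    (Filter.eventually_of_mem (ball_mem_nhds x hδ) fun y hy => (hcont y hy).aestronglyMeasurable)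
    ((hcont x (mem_ball_self hδ)).intervalIntegrable _ _)
    (by
      refine (hKc.measurable.smul ((measurable_fderiv ℂ F).comp ?_)).aestronglyMeasurable
      exact (continuous_const.add
        ((continuous_circleMap 0 δ).smul continuous_const)).measurable)
    (Filter.Eventually.of_forall fun θ _ y hy => by
      rw [norm_smul, hKn]
      exact mul_le_mul_of_nonneg_left (hbound _ (hmem y hy _ (hcm θ))) (by positivity))
    (by simp)
    (Filter.Eventually.of_forall fun θ _ y hy => hdiff y hy θ)
  have heq : _root_.partialDeriv j F =ᶠ[nhds x] fun y => (2 * Real.pi * Complex.I : ℂ)⁻¹ *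
      ∫ θ in (0 : ℝ)..2 * Real.pi, K θ * F (y + circleMap 0 δ θ • v) := by
    filter_upwards [ball_mem_nhds x hδ] with y hy
    have hU : IsOpen ((fun ξ : ℂ => y + ξ • v) ⁻¹' s) := hs.preimage (by fun_prop)
    have hd : DifferentiableOn ℂ (fun ξ : ℂ => F (y + ξ • v)) ((fun ξ : ℂ => y + ξ • v) ⁻¹' s) :=
      hF.comp (by fun_prop) fun ξ hξ => hξ
    have hc := Complex.two_pi_I_inv_smul_circleIntegral_sub_sq_inv_smul_of_differentiable
      (c := 0) (w₀ := 0) (R := δ) hU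
      (fun ξ hξ => h23 (hmem y hy ξ (by simpa using hξ))) hd (mem_ball_self hδ)
    have hy0 : y + (0 : ℂ) • v ∈ s := h23 (hmem y hy 0 (by simpa using hδ.le))
    have hder : HasDerivAt (fun ξ : ℂ => F (y + ξ • v)) (fderiv ℂ F (y + (0 : ℂ) • v) v) 0 := by
      have h1 := (hF.differentiableAt (hs.mem_nhds hy0)).hasFDerivAt
      have h2 : HasDerivAt (fun ξ : ℂ => y + ξ • v) v 0 := by
        simpa using ((hasDerivAt_id (0 : ℂ)).smul_const v).const_add y
      exact h1.comp_hasDerivAt 0 h2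
    rw [hder.deriv] at hc
    rw [zero_smul, add_zero] at hc
    rw [_root_.partialDeriv, ← hc, smul_eq_mul, circleIntegral]
    congr 2
    ext θ
    simp only [hK, smul_eq_mul, mul_assoc]
  exact ((key.const_mul _).congr_of_eventuallyEq heq).differentiableAt.differentiableWithinAt

/-! ### Calculus of partial derivatives, and derivatives along rays and slices. -/

section PartialDeriv

variable {n : ℕ} {F G : (Fin n → ℂ) → ℂ} {s : Set (Fin n → ℂ)} {z : Fin n → ℂ}

lemma fderiv_eq_sum_partialDeriv (F : (Fin n → ℂ) → ℂ) (z : Fin n → ℂ) :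
    fderiv ℂ F z = ∑ j, partialDeriv j F z •
      (ContinuousLinearMap.proj j : (Fin n → ℂ) →L[ℂ] ℂ) := by
  ext v
  conv_lhs => rw [← Finset.univ_sum_single v, map_sum]
  rw [sum_apply]
  refine Finset.sum_congr rfl fun j _ => ?_
  have : (Pi.single j (v j) : Fin n → ℂ) = v j • Pi.single j 1 := by
    rw [← Pi.single_smul, smul_eq_mul, mul_one]
  rw [this, map_smul, partialDeriv, smul_eq_mul]
  simp [mul_comm]

lemma fderiv_apply_eq_sum (F : (Fin n → ℂ) → ℂ) (z v : Fin n → ℂ) :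
    fderiv ℂ F z v = ∑ j, v j * partialDeriv j F z := by
  rw [fderiv_eq_sum_partialDeriv, sum_apply]
  exact Finset.sum_congr rfl fun j _ => by simp [mul_comm]

/-- Second partial derivatives of a holomorphic function commute. -/
theorem partialDeriv_comm (hF : DifferentiableOn ℂ F s) (hs : IsOpen s) (hz : z ∈ s)
    (i j : Fin n) :
    partialDeriv i (partialDeriv j F) z = partialDeriv j (partialDeriv i F) z := by
  have hpart : ∀ k, DifferentiableAt ℂ (partialDeriv k F) z := fun k =>
    (hF.partialDeriv hs k).differentiableAt (hs.mem_nhds hz)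
  have hd : DifferentiableAt ℂ (fderiv ℂ F) z := by
    rw [show fderiv ℂ F = fun z => ∑ j, partialDeriv j F z •
      (ContinuousLinearMap.proj j : (Fin n → ℂ) →L[ℂ] ℂ) from
        funext (fderiv_eq_sum_partialDeriv F)]
    exact DifferentiableAt.fun_sum fun k _ => (hpart k).smul_const _
  have hsymm := second_derivative_symmetric_of_eventually (f := F) (f' := fderiv ℂ F)
    (Filter.eventually_of_mem (hs.mem_nhds hz) fun y hy =>
      (hF.differentiableAt (hs.mem_nhds hy)).hasFDerivAt) hd.hasFDerivAt
  have happ : ∀ k l, partialDeriv k (partialDeriv l F) z =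
      fderiv ℂ (fderiv ℂ F) z (Pi.single k 1) (Pi.single l 1) := by
    intro k l
    have h := hd.hasFDerivAt.clm_apply (hasFDerivAt_const (Pi.single l (1 : ℂ)) z)
    rw [partialDeriv, show partialDeriv l F = fun y => fderiv ℂ F y (Pi.single l 1) from rfl,
      h.fderiv]
    simp
  rw [happ, happ, hsymm]

lemma partialDeriv_congr (h : F =ᶠ[nhds z] G) (j : Fin n) :
    partialDeriv j F z = partialDeriv j G z := by
  rw [partialDeriv, partialDeriv, h.fderiv_eq]

lemma partialDeriv_add (hF : DifferentiableAt ℂ F z) (hG : DifferentiableAt ℂ G z) (j : Fin n) :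
    partialDeriv j (fun w => F w + G w) z = partialDeriv j F z + partialDeriv j G z := by
  simp [partialDeriv, fderiv_fun_add hF hG]

lemma partialDeriv_const_mul (c : ℂ) (hF : DifferentiableAt ℂ F z) (j : Fin n) :
    partialDeriv j (fun w => c * F w) z = c * partialDeriv j F z := by
  simp [partialDeriv, fderiv_const_mul hF]

lemma partialDeriv_const (c : ℂ) (j : Fin n) : partialDeriv j (fun _ => c) z = 0 := by
  simp [partialDeriv]

lemma partialDeriv_sum {ι : Type*} {u : Finset ι} {A : ι → (Fin n → ℂ) → ℂ}
    (hA : ∀ i ∈ u, DifferentiableAt ℂ (A i) z) (j : Fin n) :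
    partialDeriv j (fun w => ∑ i ∈ u, A i w) z = ∑ i ∈ u, partialDeriv j (A i) z := by
  simp [partialDeriv, fderiv_fun_sum hA]

lemma partialDeriv_mul (hF : DifferentiableAt ℂ F z) (hG : DifferentiableAt ℂ G z) (j : Fin n) :
    partialDeriv j (fun w => F w * G w) z =
      partialDeriv j F z * G z + F z * partialDeriv j G z := by
  simp [partialDeriv, fderiv_fun_mul hF hG]
  ring

lemma partialDeriv_div (hF : DifferentiableAt ℂ F z) (hG : DifferentiableAt ℂ G z) (h : G z ≠ 0)
    (j : Fin n) :
    partialDeriv j (fun w => F w / G w) z =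
      (partialDeriv j F z * G z - F z * partialDeriv j G z) / G z ^ 2 := by
  have hd : DifferentiableAt ℂ (fun w => F w / G w) z := by
    simp only [div_eq_mul_inv]
    exact hF.mul (hG.inv h)
  have h1 := partialDeriv_mul hd hG j
  have h2 : (fun w => F w / G w * G w) =ᶠ[nhds z] F := by
    filter_upwards [hG.continuousAt.eventually_ne h] with w hw
    field_simp
  rw [partialDeriv_congr h2] at h1
  rw [h1]
  field_simp
  ring

/-- The derivative along a real ray from the origin. -/
lemma hasDerivAt_ray {t : ℝ} {ζ : Fin n → ℂ} (hF : DifferentiableAt ℂ F (t • ζ)) :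
    HasDerivAt (fun t : ℝ => F (t • ζ)) (∑ j, ζ j * partialDeriv j F (t • ζ)) t := by
  have h2 : HasDerivAt (fun t : ℝ => t • ζ) ζ t := by
    simpa using (hasDerivAt_id t).smul_const ζ
  rw [← fderiv_apply_eq_sum]
  exact (hF.hasFDerivAt.restrictScalars ℝ).comp_hasDerivAt t h2

/-- The derivative along a coordinate slice. -/
lemma hasDerivAt_comp_update {w : ℂ} {m : Fin n}
    (hF : DifferentiableAt ℂ F (Function.update z m w)) :
    HasDerivAt (fun w => F (Function.update z m w))
      (partialDeriv m F (Function.update z m w)) w :=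
  hF.hasFDerivAt.comp_hasDerivAt w (hasDerivAt_update z m w)

end PartialDeriv

/-! ### Estimates for holomorphic functions on the unit disc. -/

section UnitDisc

open Metric ComplexConjugate

lemma one_add_conj_mul_ne_zero {z ξ : ℂ} (hz : ‖z‖ < 1) (hξ : ‖ξ‖ < 1) : 1 + conj z * ξ ≠ 0 := by
  intro h
  have h1 : ‖conj z * ξ‖ = 1 := by
    rw [show conj z * ξ = -1 by linear_combination h]
    simp
  rw [norm_mul, RCLike.norm_conj] at h1
  nlinarith [norm_nonneg z, norm_nonneg ξ]

/-- The disc automorphism that maps `0` to `z`. -/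
def discAutomorphism (z ξ : ℂ) : ℂ := (ξ + z) / (1 + conj z * ξ)

lemma one_sub_norm_discAutomorphism_sq {z ξ : ℂ} (hz : ‖z‖ < 1) (hξ : ‖ξ‖ < 1) :
    1 - ‖discAutomorphism z ξ‖ ^ 2 =
      (1 - ‖z‖ ^ 2) * (1 - ‖ξ‖ ^ 2) / ‖1 + conj z * ξ‖ ^ 2 := by
  have h0 : ‖1 + conj z * ξ‖ ^ 2 ≠ 0 := by
    simpa using one_add_conj_mul_ne_zero hz hξ
  rw [discAutomorphism, norm_div, div_pow, eq_div_iff h0, sub_mul, div_mul_cancel₀ _ h0]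
  simp only [← Complex.normSq_eq_norm_sq, Complex.normSq_apply, Complex.add_re, Complex.add_im,
    Complex.mul_re, Complex.mul_im, Complex.conj_re, Complex.conj_im, Complex.one_re,
    Complex.one_im]
  ring

lemma one_sub_sq_pos {x : ℝ} (h0 : 0 ≤ x) (h1 : x < 1) : 0 < 1 - x ^ 2 := by nlinarith

lemma discAutomorphism_mem_ball {z ξ : ℂ} (hz : ‖z‖ < 1) (hξ : ‖ξ‖ < 1) :
    ‖discAutomorphism z ξ‖ < 1 := by
  have h := one_sub_norm_discAutomorphism_sq hz hξ
  have h1 : 0 < 1 - ‖discAutomorphism z ξ‖ ^ 2 := by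
    rw [h]
    have := one_sub_sq_pos (norm_nonneg z) hz
    have := one_sub_sq_pos (norm_nonneg ξ) hξ
    have := norm_pos_iff.2 (one_add_conj_mul_ne_zero hz hξ)
    positivity
  nlinarith [norm_nonneg (discAutomorphism z ξ)]

lemma differentiableOn_discAutomorphism {z : ℂ} (hz : ‖z‖ < 1) :
    DifferentiableOn ℂ (discAutomorphism z) (ball 0 1) := by
  intro ξ hξ
  refine DifferentiableAt.differentiableWithinAt ?_
  exact (by fun_prop : DifferentiableAt ℂ (fun ξ : ℂ => ξ + z) ξ).div (by fun_prop)
    (one_add_conj_mul_ne_zero hz (by simpa using hξ))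

lemma hasDerivAt_discAutomorphism_zero (z : ℂ) :
    HasDerivAt (discAutomorphism z) (1 - (‖z‖ : ℂ) ^ 2) 0 := by
  have h1 : HasDerivAt (fun ξ : ℂ => ξ + z) 1 0 := (hasDerivAt_id 0).add_const z
  have h2 : HasDerivAt (fun ξ : ℂ => 1 + conj z * ξ) (conj z) 0 := by
    simpa using ((hasDerivAt_id (0 : ℂ)).const_mul (conj z)).const_add 1
  have h : HasDerivAt (discAutomorphism z) _ 0 := h1.fun_div h2 (by simp)
  have h3 : z * conj z = (‖z‖ : ℂ) ^ 2 := Complex.mul_conj' z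
  refine h.congr_deriv ?_
  rw [← h3]
  simp

variable {g : ℂ → ℂ} {z : ℂ}

lemma differentiableOn_comp_discAutomorphism (hg : DifferentiableOn ℂ g (ball 0 1))
    (hz : ‖z‖ < 1) : DifferentiableOn ℂ (fun ξ => g (discAutomorphism z ξ)) (ball 0 1) :=
  hg.comp (differentiableOn_discAutomorphism hz) fun ξ hξ => by
    simpa using discAutomorphism_mem_ball hz (by simpa using hξ)

lemma norm_deriv_comp_discAutomorphism (hg : DifferentiableOn ℂ g (ball 0 1)) (hz : ‖z‖ < 1) :
    ‖deriv (fun ξ => g (discAutomorphism z ξ)) 0‖ = ‖deriv g z‖ * (1 - ‖z‖ ^ 2) := by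
  have h0 : discAutomorphism z 0 = z := by simp [discAutomorphism]
  have h1 : HasDerivAt g (deriv g z) (discAutomorphism z 0) := by
    rw [h0]
    exact (hg.differentiableAt (isOpen_ball.mem_nhds (by simpa using hz))).hasDerivAt
  have h2 : HasDerivAt (fun ξ => g (discAutomorphism z ξ)) _ 0 :=
    h1.comp 0 (hasDerivAt_discAutomorphism_zero z)
  rw [h2.deriv, norm_mul]
  congr 1
  rw [← Complex.ofReal_pow, ← Complex.ofReal_one, ← Complex.ofReal_sub, Complex.norm_real,
    Real.norm_of_nonneg (one_sub_sq_pos (norm_nonneg z) hz).le]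

/-- The Schwarz-Pick estimate for the derivative of a bounded holomorphic function. -/
theorem norm_deriv_le_of_norm_le_unitDisc {M : ℝ} (hg : DifferentiableOn ℂ g (ball 0 1))
    (hM : ∀ w, ‖w‖ < 1 → ‖g w‖ ≤ M) (hz : ‖z‖ < 1) : ‖deriv g z‖ ≤ M / (1 - ‖z‖ ^ 2) := by
  have hpos := one_sub_sq_pos (norm_nonneg z) hz
  rw [le_div_iff₀ hpos, ← norm_deriv_comp_discAutomorphism hg hz]
  have hr : ∀ r : ℝ, r < 1 →
      r * ‖deriv (fun ξ => g (discAutomorphism z ξ)) 0‖ ≤ M := by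
    intro r hr1
    rcases le_or_gt r 0 with hr0 | hr0
    · exact (mul_nonpos_of_nonpos_of_nonneg hr0 (norm_nonneg _)).trans
        ((norm_nonneg _).trans (hM z hz))
    · have hsub : closedBall (0 : ℂ) r ⊆ ball 0 1 := closedBall_subset_ball hr1
      have := Complex.norm_deriv_le_of_forall_mem_sphere_norm_le hr0
        (((differentiableOn_comp_discAutomorphism hg hz).mono hsub).diffContOnCl_ball subset_rfl)
        (fun ξ hξ => hM _ (discAutomorphism_mem_ball hz
          (by simpa using hsub (sphere_subset_closedBall hξ))))
      rw [le_div_iff₀ hr0] at this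
      linarith
  -- The limit `r → 1` in concrete form: if `M < d`, the radius `(M + d) / (2d)` lies strictly
  -- between `M / d` and `1`.
  by_contra! hlt
  set d := ‖deriv (fun ξ => g (discAutomorphism z ξ)) 0‖
  have hd : 0 < d := lt_of_le_of_lt ((norm_nonneg _).trans (hM z hz)) hlt
  have h2 : (M + d) / 2 / d < 1 := by rw [div_lt_one hd]; linarith
  have := hr _ h2
  rw [div_mul_cancel₀ _ hd.ne'] at this
  linarith

/-- A holomorphic function on the disc that tends to zero at the boundary vanishes. -/
theorem eq_zero_of_norm_le_one_sub_sq {C : ℝ} (hg : DifferentiableOn ℂ g (ball 0 1))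
    (hC : ∀ w, ‖w‖ < 1 → ‖g w‖ ≤ C * (1 - ‖w‖ ^ 2)) (hz : ‖z‖ < 1) : g z = 0 := by
  -- The maximum principle on the disc of radius `r`; the bound tends to `0` as `r → 1`.
  have hr : ∀ r : ℝ, ‖z‖ < r → r < 1 → ‖g z‖ ≤ C * (1 - r ^ 2) := by
    intro r hzr hr1
    have hr0 : 0 < r := (norm_nonneg z).trans_lt hzr
    refine Complex.norm_le_of_forall_mem_frontier_norm_le (U := ball 0 r) isBounded_ball
      ((hg.mono (closedBall_subset_ball hr1)).diffContOnCl_ball subset_rfl)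
      (fun w hw => ?_) (subset_closure (by simpa using hzr))
    rw [frontier_ball _ hr0.ne', mem_sphere_zero_iff_norm] at hw
    rw [← hw]
    exact hC w (hw.trans_lt hr1)
  have hlim : Filter.Tendsto (fun r : ℝ => C * (1 - r ^ 2)) (nhdsWithin 1 (Set.Iio 1)) (nhds 0) := by
    have : Continuous fun r : ℝ => C * (1 - r ^ 2) := by fun_prop
    simpa using (this.tendsto 1).mono_left nhdsWithin_le_nhds
  have : ‖g z‖ ≤ 0 := by
    refine ge_of_tendsto hlim ?_
    filter_upwards [Ioo_mem_nhdsLT hz] with r hr'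
    exact hr r hr'.1 hr'.2
  simpa using this

/-- A Cauchy estimate on a circle about the origin with a mean value of the bound. -/
lemma norm_deriv_zero_le_of_norm_le_mul {h : ℂ → ℂ} {r B : ℝ} {a : ℂ} (hr : 0 < r) (hr1 : r < 1)
    (hh : DifferentiableOn ℂ h (ball 0 1))
    (hB : ∀ ξ, ‖ξ‖ = r → ‖h ξ‖ ≤ B * ‖1 + a * ξ‖ ^ 2) :
    ‖deriv h 0‖ ≤ B * (1 + ‖a‖ ^ 2 * r ^ 2) / r := by
  have hc := Complex.two_pi_I_inv_smul_circleIntegral_sub_sq_inv_smul_of_differentiable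
    (c := 0) (w₀ := 0) (R := r) isOpen_ball (closedBall_subset_ball hr1) hh (mem_ball_self hr)
  have hpi := Real.pi_pos
  rw [← hc, norm_smul, circleIntegral]
  have hbound : ‖∫ θ in (0 : ℝ)..2 * Real.pi, deriv (circleMap 0 r) θ •
      ((circleMap 0 r θ - 0) ^ 2)⁻¹ • h (circleMap 0 r θ)‖ ≤
      ∫ θ in (0 : ℝ)..2 * Real.pi, B / r * (1 + ‖a‖ ^ 2 * r ^ 2 +
        2 * r * (a.re * Real.cos θ - a.im * Real.sin θ)) := by
    refine intervalIntegral.norm_integral_le_of_norm_le (by positivity)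
      (Filter.Eventually.of_forall fun θ _ => ?_) (Continuous.intervalIntegrable (by fun_prop) _ _)
    have h1 := hB (circleMap 0 r θ) (by simp [abs_of_pos hr])
    have h2 : ‖1 + a * circleMap 0 r θ‖ ^ 2 = 1 + ‖a‖ ^ 2 * r ^ 2 +
        2 * r * (a.re * Real.cos θ - a.im * Real.sin θ) := by
      have : circleMap 0 r θ = ((r * Real.cos θ : ℝ) : ℂ) + ((r * Real.sin θ : ℝ) : ℂ) * Complex.I := by
        rw [circleMap_zero, Complex.exp_mul_I]
        push_cast
        ring
      rw [this]
      simp only [← Complex.normSq_eq_norm_sq, Complex.normSq_apply, Complex.add_re, Complex.add_im,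
        Complex.mul_re, Complex.mul_im, Complex.one_re, Complex.one_im, Complex.ofReal_re,
        Complex.ofReal_im, Complex.I_re, Complex.I_im]
      linear_combination ((a.re ^ 2 + a.im ^ 2) * r ^ 2) * Real.sin_sq_add_cos_sq θ
    rw [h2] at h1
    rw [norm_smul, norm_smul, deriv_circleMap, sub_zero, norm_mul, norm_inv, norm_pow,
      norm_circleMap_zero, Complex.norm_I, abs_of_pos hr]
    calc r * 1 * ((r ^ 2)⁻¹ * ‖h (circleMap 0 r θ)‖) = ‖h (circleMap 0 r θ)‖ / r := by field_simp
      _ ≤ _ := by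
        rw [div_mul_eq_mul_div]
        gcongr
  -- The cross term of `|1 + aξ|²` has mean zero over the circle. Taking the supremum would give the
  -- larger factor `(1 + |a| r)²`.
  have hint : ∫ θ in (0 : ℝ)..2 * Real.pi, B / r * (1 + ‖a‖ ^ 2 * r ^ 2 +
        2 * r * (a.re * Real.cos θ - a.im * Real.sin θ)) =
      B / r * (2 * Real.pi * (1 + ‖a‖ ^ 2 * r ^ 2)) := by
    rw [intervalIntegral.integral_const_mul, intervalIntegral.integral_add,
      intervalIntegral.integral_const_mul, intervalIntegral.integral_sub,
      intervalIntegral.integral_const_mul, intervalIntegral.integral_const_mul]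
    · simp
      left
      ring
    all_goals exact Continuous.intervalIntegrable (by fun_prop) _ _
  rw [hint] at hbound
  have hn : ‖(2 * Real.pi * Complex.I : ℂ)⁻¹‖ = (2 * Real.pi)⁻¹ := by
    simp [abs_of_pos hpi]
  rw [hn]
  refine (mul_le_mul_of_nonneg_left hbound (by positivity)).trans_eq ?_
  field_simp

/-- The derivative of a holomorphic function bounded by a multiple of `(1 - |w|²)⁻¹`. -/
theorem norm_deriv_le_of_norm_le_div_one_sub_sq {M : ℝ} (hg : DifferentiableOn ℂ g (ball 0 1))
    (hM : ∀ w, ‖w‖ < 1 → ‖g w‖ ≤ M / (1 - ‖w‖ ^ 2)) (hz : ‖z‖ < 1) :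
    ‖deriv g z‖ ≤ 10 / 3 * M / (1 - ‖z‖ ^ 2) ^ 2 := by
  have hpos := one_sub_sq_pos (norm_nonneg z) hz
  have hM0 : 0 ≤ M := by
    have := (norm_nonneg _).trans (hM 0 (by simp))
    simpa using this
  -- Move `z` to the origin and use the circle of radius `1/2`, where `1 - |ξ|² = 3/4`. The constant
  -- is `2 · (4/3) · (1 + |z|²/4) ≤ 10/3`.
  have key := norm_deriv_zero_le_of_norm_le_mul (h := fun ξ => g (discAutomorphism z ξ))
    (r := 1 / 2) (B := M / ((1 - ‖z‖ ^ 2) * (3 / 4))) (a := conj z) (by norm_num) (by norm_num)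
    (differentiableOn_comp_discAutomorphism hg hz) (fun ξ hξ => by
      have hξ1 : ‖ξ‖ < 1 := by rw [hξ]; norm_num
      refine (hM _ (discAutomorphism_mem_ball hz hξ1)).trans_eq ?_
      have h0 : ‖1 + conj z * ξ‖ ≠ 0 := by simpa using one_add_conj_mul_ne_zero hz hξ1
      rw [one_sub_norm_discAutomorphism_sq hz hξ1, hξ]
      field_simp
      ring)
  rw [norm_deriv_comp_discAutomorphism hg hz, RCLike.norm_conj] at key
  rw [le_div_iff₀ (by positivity)]
  calc ‖deriv g z‖ * (1 - ‖z‖ ^ 2) ^ 2 = ‖deriv g z‖ * (1 - ‖z‖ ^ 2) * (1 - ‖z‖ ^ 2) := by ring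
    _ ≤ M / ((1 - ‖z‖ ^ 2) * (3 / 4)) * (1 + ‖z‖ ^ 2 * (1 / 2) ^ 2) / (1 / 2) * (1 - ‖z‖ ^ 2) := by
        gcongr
    _ = 8 / 3 * M * (1 + ‖z‖ ^ 2 / 4) := by field_simp; ring
    _ ≤ 10 / 3 * M := by nlinarith [mul_nonneg hM0 hpos.le]

end UnitDisc

/-! ### Differentiating determinants and inverse matrices. -/

section Determinant

variable {n : ℕ} {z : Fin n → ℂ}

lemma differentiableAt_finset_prod {ι : Type*} {u : Finset ι} {A : ι → (Fin n → ℂ) → ℂ}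
    (hA : ∀ i ∈ u, DifferentiableAt ℂ (A i) z) :
    DifferentiableAt ℂ (fun w => ∏ i ∈ u, A i w) z := by
  classical
  exact (HasFDerivAt.finsetProd fun i hi => (hA i hi).hasFDerivAt).differentiableAt

lemma differentiableAt_det {m : ℕ} {A : (Fin n → ℂ) → Matrix (Fin m) (Fin m) ℂ}
    (hA : ∀ i j, DifferentiableAt ℂ (fun w => A w i j) z) :
    DifferentiableAt ℂ (fun w => (A w).det) z := by
  simp only [Matrix.det_apply']
  refine DifferentiableAt.fun_sum fun σ _ => DifferentiableAt.const_mul ?_ _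
  exact differentiableAt_finset_prod fun i _ => hA _ _

lemma differentiableAt_inv_apply {m : ℕ} {A : (Fin n → ℂ) → Matrix (Fin m) (Fin m) ℂ}
    (hA : ∀ i j, DifferentiableAt ℂ (fun w => A w i j) z) (h0 : (A z).det ≠ 0) (i j : Fin m) :
    DifferentiableAt ℂ (fun w => (A w)⁻¹ i j) z := by
  simp only [Matrix.inv_def, Ring.inverse_eq_inv', Matrix.smul_apply, smul_eq_mul,
    Matrix.adjugate_apply]
  refine ((differentiableAt_det hA).inv h0).mul (differentiableAt_det fun k l => ?_)
  simp only [Matrix.updateRow_apply]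
  split_ifs
  · exact differentiableAt_const _
  · exact hA k l

lemma partialDeriv_finset_prod {ι : Type*} [DecidableEq ι] {u : Finset ι}
    {A : ι → (Fin n → ℂ) → ℂ} (hA : ∀ i ∈ u, DifferentiableAt ℂ (A i) z) (j : Fin n) :
    partialDeriv j (fun w => ∏ i ∈ u, A i w) z =
      ∑ i ∈ u, (∏ k ∈ u.erase i, A k z) * partialDeriv j (A i) z := by
  have h : HasFDerivAt (fun w => ∏ i ∈ u, A i w) _ z :=
    HasFDerivAt.finsetProd fun i hi => (hA i hi).hasFDerivAt
  rw [partialDeriv, h.fderiv]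
  simp [partialDeriv]

/-- The derivative of a determinant at a point where the matrix is the identity. -/
lemma partialDeriv_det_of_eq_one {m : ℕ} {B : (Fin n → ℂ) → Matrix (Fin m) (Fin m) ℂ}
    (hB : ∀ i j, DifferentiableAt ℂ (fun w => B w i j) z) (h1 : B z = 1) (j : Fin n) :
    partialDeriv j (fun w => (B w).det) z = ∑ k, partialDeriv j (fun w => B w k k) z := by
  simp only [Matrix.det_apply']
  have hp : ∀ σ : Equiv.Perm (Fin m), DifferentiableAt ℂ (fun w => ∏ i, B w (σ i) i) z :=
    fun σ => differentiableAt_finset_prod fun i _ => hB _ _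
  rw [partialDeriv_sum fun σ _ => (hp σ).const_mul _]
  rw [Finset.sum_eq_single 1]
  · rw [partialDeriv_const_mul _ (hp _),
      partialDeriv_finset_prod fun i _ => hB _ _]
    simp [h1]
  · intro σ _ hσ
    rw [partialDeriv_const_mul _ (hp _),
      partialDeriv_finset_prod fun i _ => hB _ _]
    -- A nontrivial permutation moves at least the two indices `i` and `σ i`, so after one factor is
    -- differentiated an off-diagonal entry of the identity remains in the product.
    have hex : ∃ i, σ i ≠ i := by
      by_contra! h
      exact hσ (Equiv.ext h)
    obtain ⟨i, hi⟩ := hex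
    refine mul_eq_zero_of_right _ (Finset.sum_eq_zero fun k _ => mul_eq_zero_of_left ?_ _)
    by_cases hk : k = i
    · refine Finset.prod_eq_zero (i := σ i) (by simp [hk, hi]) ?_
      rw [h1, Matrix.one_apply_ne]
      exact fun h => hi (σ.injective h)
    · refine Finset.prod_eq_zero (i := i) (by simp [Ne.symm hk]) ?_
      rw [h1, Matrix.one_apply_ne hi]
  · simp

/-- Jacobi's formula for the derivative of a determinant. -/
theorem partialDeriv_det {m : ℕ} {A : (Fin n → ℂ) → Matrix (Fin m) (Fin m) ℂ}
    (hA : ∀ i j, DifferentiableAt ℂ (fun w => A w i j) z) (h0 : (A z).det ≠ 0) (j : Fin n) :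
    partialDeriv j (fun w => (A w).det) z =
      (A z).det * ∑ k, ∑ l, partialDeriv j (fun w => A w l k) z * (A z)⁻¹ k l := by
  have hu : IsUnit (A z).det := isUnit_iff_ne_zero.2 h0
  have hB : ∀ i k, DifferentiableAt ℂ (fun w => ((A z)⁻¹ * A w) i k) z := by
    intro i k
    simp only [Matrix.mul_apply]
    exact DifferentiableAt.fun_sum fun l _ => (hA l k).const_mul _
  have h2 : (fun w => (A w).det) = fun w => (A z).det * ((A z)⁻¹ * A w).det := by
    ext w
    rw [Matrix.det_mul, ← mul_assoc, ← Matrix.det_mul, Matrix.mul_nonsing_inv _ hu, Matrix.det_one,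
      one_mul]
  rw [h2, partialDeriv_const_mul _ (differentiableAt_det hB),
    partialDeriv_det_of_eq_one hB (Matrix.nonsing_inv_mul _ hu)]
  congr 1
  refine Finset.sum_congr rfl fun k _ => ?_
  simp only [Matrix.mul_apply]
  rw [partialDeriv_sum fun l _ => (hA l k).const_mul _]
  refine Finset.sum_congr rfl fun l _ => ?_
  rw [partialDeriv_const_mul _ (hA l k), mul_comm]

end Determinant

/-! ### The flat connection induced by `f` and its trace-free part, the Schwarzian. -/

section ProjectiveConnection

variable {n : ℕ}

/-- The coefficients `∑ₗ (∂²fₗ/∂zᵢ∂zⱼ) (∂zₖ/∂fₗ)` of the affine connection induced by `f`. -/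
def christoffel (f : (Fin n → ℂ) → (Fin n → ℂ)) (i j k : Fin n) (z : Fin n → ℂ) : ℂ :=
  ∑ l, partialDeriv i (partialDeriv j (fun w => f w l)) z * (jacobianMatrix f z)⁻¹ k l

/-- The logarithmic derivative `∂ᵢ log u` of `u = J_f ^ (-1 / (n + 1))`. -/
def logDerivRootJacobian (f : (Fin n → ℂ) → (Fin n → ℂ)) (i : Fin n) (z : Fin n → ℂ) : ℂ :=
  -(1 / ((n : ℂ) + 1)) * partialLogJacobian i f z

/-- The zeroth order coefficient `S⁰ᵢⱼ f` of the linear system `uᵢⱼ = ∑ₖ Sᵏᵢⱼ uₖ + S⁰ᵢⱼ u` that is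
satisfied by `u = J_f ^ (-1 / (n + 1))`. -/
def schwarzianPotential (f : (Fin n → ℂ) → (Fin n → ℂ)) (i j : Fin n) (z : Fin n → ℂ) : ℂ :=
  partialDeriv i (logDerivRootJacobian f j) z
    + logDerivRootJacobian f i z * logDerivRootJacobian f j z
    - ∑ k, schwarzianDeriv f i j k z * logDerivRootJacobian f k z

lemma schwarzianDeriv_eq (f : (Fin n → ℂ) → (Fin n → ℂ)) (i j k : Fin n) (z : Fin n → ℂ) :
    schwarzianDeriv f i j k z = christoffel f i j k z
      + ((if k = i then 1 else 0) * logDerivRootJacobian f j z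
        + (if k = j then 1 else 0) * logDerivRootJacobian f i z) := by
  rw [schwarzianDeriv, christoffel, logDerivRootJacobian, logDerivRootJacobian]
  ring

variable {f : (Fin n → ℂ) → (Fin n → ℂ)} {s : Set (Fin n → ℂ)} {z : Fin n → ℂ}

lemma differentiableOn_component (hf : DifferentiableOn ℂ f s) (l : Fin n) :
    DifferentiableOn ℂ (fun w => f w l) s := fun x hx => differentiableWithinAt_pi.1 (hf x hx) l

lemma differentiableOn_jacobianMatrix_apply (hs : IsOpen s) (hf : DifferentiableOn ℂ f s)
    (i j : Fin n) : DifferentiableOn ℂ (fun w => jacobianMatrix f w i j) s :=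
  (differentiableOn_component hf i).partialDeriv hs j

lemma differentiableOn_jacobian (hs : IsOpen s) (hf : DifferentiableOn ℂ f s) :
    DifferentiableOn ℂ (jacobian f) s := fun _ hx =>
  (differentiableAt_det fun i j =>
    (differentiableOn_jacobianMatrix_apply hs hf i j).differentiableAt
      (hs.mem_nhds hx)).differentiableWithinAt

lemma differentiableOn_christoffel (hs : IsOpen s) (hf : DifferentiableOn ℂ f s)
    (hJ : ∀ z ∈ s, jacobian f z ≠ 0) (i j k : Fin n) :
    DifferentiableOn ℂ (christoffel f i j k) s := by
  intro x hx
  refine DifferentiableAt.differentiableWithinAt (DifferentiableAt.fun_sum fun l _ => ?_)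
  exact ((((differentiableOn_component hf l).partialDeriv hs j).partialDeriv hs
    i).differentiableAt (hs.mem_nhds hx)).mul (differentiableAt_inv_apply (fun i j =>
      (differentiableOn_jacobianMatrix_apply hs hf i j).differentiableAt (hs.mem_nhds hx))
        (hJ x hx) k l)

lemma differentiableOn_logDerivRootJacobian (hs : IsOpen s) (hf : DifferentiableOn ℂ f s)
    (hJ : ∀ z ∈ s, jacobian f z ≠ 0) (i : Fin n) :
    DifferentiableOn ℂ (logDerivRootJacobian f i) s := by
  have h := differentiableOn_jacobian hs hf
  have h2 := ((h.partialDeriv hs i).mul (h.inv hJ)).const_mul (-(1 / ((n : ℂ) + 1)))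
  refine h2.congr fun x _ => ?_
  simp [logDerivRootJacobian, partialLogJacobian, div_eq_mul_inv]

lemma differentiableOn_schwarzianDeriv (hs : IsOpen s) (hf : DifferentiableOn ℂ f s)
    (hJ : ∀ z ∈ s, jacobian f z ≠ 0) (i j k : Fin n) :
    DifferentiableOn ℂ (schwarzianDeriv f i j k) s := by
  have h := (differentiableOn_christoffel hs hf hJ i j k).add
    (((differentiableOn_logDerivRootJacobian hs hf hJ j).const_mul (if k = i then 1 else 0)).add
      ((differentiableOn_logDerivRootJacobian hs hf hJ i).const_mul (if k = j then 1 else 0)))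
  exact h.congr fun x _ => schwarzianDeriv_eq f i j k x

lemma christoffel_comm (hs : IsOpen s) (hf : DifferentiableOn ℂ f s) (hz : z ∈ s)
    (i j k : Fin n) : christoffel f i j k z = christoffel f j i k z :=
  Finset.sum_congr rfl fun l _ => by
    rw [partialDeriv_comm (differentiableOn_component hf l) hs hz]

lemma schwarzianDeriv_comm (hs : IsOpen s) (hf : DifferentiableOn ℂ f s) (hz : z ∈ s)
    (i j k : Fin n) : schwarzianDeriv f i j k z = schwarzianDeriv f j i k z := by
  rw [schwarzianDeriv_eq, schwarzianDeriv_eq, christoffel_comm hs hf hz]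
  ring

/-- By Jacobi's formula the trace of the connection is `d log J_f`. -/
lemma sum_christoffel (hs : IsOpen s) (hf : DifferentiableOn ℂ f s)
    (hJ : ∀ z ∈ s, jacobian f z ≠ 0) (hz : z ∈ s) (i : Fin n) :
    ∑ k, christoffel f i k k z = -((n : ℂ) + 1) * logDerivRootJacobian f i z := by
  have h := partialDeriv_det (A := jacobianMatrix f) (z := z) (fun k l =>
      (differentiableOn_jacobianMatrix_apply hs hf k l).differentiableAt (hs.mem_nhds hz))
        (hJ z hz) i
  have h1 : ((n : ℂ) + 1) ≠ 0 := Nat.cast_add_one_ne_zero n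
  have h2 : partialLogJacobian i f z = ∑ k, christoffel f i k k z := by
    rw [partialLogJacobian, div_eq_iff (hJ z hz), mul_comm]
    exact h
  rw [logDerivRootJacobian, h2]
  field_simp

/-- The trace of the two `δ` terms is `(n + 1) vᵢ` with `v = d log J_f^(-1/(n+1))`, which cancels
the trace of the connection; this explains the factor `1/(n+1)` in the Schwarzian. -/
lemma sum_schwarzianDeriv (hs : IsOpen s) (hf : DifferentiableOn ℂ f s)
    (hJ : ∀ z ∈ s, jacobian f z ≠ 0) (hz : z ∈ s) (i : Fin n) :
    ∑ k, schwarzianDeriv f i k k z = 0 := by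
  simp only [schwarzianDeriv_eq, Finset.sum_add_distrib, sum_christoffel hs hf hJ hz]
  simp
  ring

/-- Multiplying by `Df` undoes the inverse matrix. This is the second order equation satisfied by
every component of `f`, and hence by every affine function of `f`. -/
lemma sum_partialDeriv_mul_christoffel (hJ : jacobian f z ≠ 0) (i j m : Fin n) :
    ∑ k, partialDeriv k (fun w => f w m) z * christoffel f i j k z =
      partialDeriv i (partialDeriv j (fun w => f w m)) z := by
  have hu : IsUnit (jacobianMatrix f z).det := isUnit_iff_ne_zero.2 hJ
  simp only [christoffel, Finset.mul_sum]
  rw [Finset.sum_comm]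
  have h : ∀ l, ∑ k, partialDeriv k (fun w => f w m) z * (jacobianMatrix f z)⁻¹ k l =
      (1 : Matrix (Fin n) (Fin n) ℂ) m l := by
    intro l
    rw [← Matrix.mul_nonsing_inv _ hu, Matrix.mul_apply]
    rfl
  calc _ = ∑ l, partialDeriv i (partialDeriv j (fun w => f w l)) z *
        ∑ k, partialDeriv k (fun w => f w m) z * (jacobianMatrix f z)⁻¹ k l := by
        refine Finset.sum_congr rfl fun l _ => ?_
        rw [Finset.mul_sum]
        exact Finset.sum_congr rfl fun k _ => by ring
    _ = _ := by simp [h, Matrix.one_apply]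

/-- The affine connection induced by `f` is flat. -/
lemma christoffel_flat (hs : IsOpen s) (hf : DifferentiableOn ℂ f s)
    (hJ : ∀ z ∈ s, jacobian f z ≠ 0) (hz : z ∈ s) (l i j k : Fin n) :
    partialDeriv l (christoffel f i j k) z
        + ∑ p, christoffel f l p k z * christoffel f i j p z =
      partialDeriv i (christoffel f l j k) z
        + ∑ p, christoffel f i p k z * christoffel f l j p z := by
  set X : Fin n → Fin n → Fin n → ℂ := fun l i k => partialDeriv l (christoffel f i j k) z
        + ∑ p, christoffel f l p k z * christoffel f i j p z with hX
  -- `Df` applied to the vector `X l i` gives third derivatives of `f`. Their symmetry in `l, i`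
  -- passes to `X` because `Df` is invertible.
  have hthird : ∀ l i m, ∑ k, jacobianMatrix f z m k * X l i k =
      partialDeriv l (partialDeriv i (partialDeriv j (fun w => f w m))) z := by
    intro l i m
    have hfm := differentiableOn_component hf m
    have hd : ∀ k, DifferentiableAt ℂ (partialDeriv k (fun w => f w m)) z := fun k =>
      (hfm.partialDeriv hs k).differentiableAt (hs.mem_nhds hz)
    have hc : ∀ k, DifferentiableAt ℂ (christoffel f i j k) z := fun k =>
      (differentiableOn_christoffel hs hf hJ i j k).differentiableAt (hs.mem_nhds hz)
    have hev : partialDeriv i (partialDeriv j (fun w => f w m)) =ᶠ[nhds z] fun w =>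
        ∑ k, partialDeriv k (fun w => f w m) w * christoffel f i j k w :=
      Filter.eventually_of_mem (hs.mem_nhds hz) fun w hw =>
        (sum_partialDeriv_mul_christoffel (hJ w hw) i j m).symm
    rw [partialDeriv_congr hev, partialDeriv_sum fun k _ => (hd k).fun_mul (hc k)]
    simp only [fun k => partialDeriv_mul (hd k) (hc k) l, Finset.sum_add_distrib]
    simp only [← sum_partialDeriv_mul_christoffel (hJ z hz) l _ m, hX, mul_add,
      Finset.sum_add_distrib, Finset.sum_mul, Finset.mul_sum]
    rw [add_comm]
    congr 1
    rw [Finset.sum_comm]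
    exact Finset.sum_congr rfl fun p _ => Finset.sum_congr rfl fun k _ => mul_assoc _ _ _ |>.symm
  have heq : (jacobianMatrix f z).mulVec (X l i) = (jacobianMatrix f z).mulVec (X i l) := by
    ext m
    have h := partialDeriv_comm ((differentiableOn_component hf m).partialDeriv hs j) hs hz l i
    rw [← hthird, ← hthird] at h
    exact h
  have hu : IsUnit (jacobianMatrix f z).det := isUnit_iff_ne_zero.2 (hJ z hz)
  have hinj := Matrix.mulVec_injective_of_isUnit ((Matrix.isUnit_iff_isUnit_det _).2 hu)
  exact congrFun (hinj heq) k

/-- The form `d log J_f` is closed; the quotient is differentiated directly, so no branch of the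
logarithm has to be chosen. -/
lemma partialDeriv_logDerivRootJacobian_comm (hs : IsOpen s) (hf : DifferentiableOn ℂ f s)
    (hJ : ∀ z ∈ s, jacobian f z ≠ 0) (hz : z ∈ s) (i j : Fin n) :
    partialDeriv i (logDerivRootJacobian f j) z =
      partialDeriv j (logDerivRootJacobian f i) z := by
  have h := differentiableOn_jacobian hs hf
  have hJd := h.differentiableAt (hs.mem_nhds hz)
  have hd : ∀ k, DifferentiableAt ℂ (partialDeriv k (jacobian f)) z := fun k =>
    (h.partialDeriv hs k).differentiableAt (hs.mem_nhds hz)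
  have hex : ∀ i j, partialDeriv i (logDerivRootJacobian f j) z = -(1 / ((n : ℂ) + 1)) *
      ((partialDeriv i (partialDeriv j (jacobian f)) z * jacobian f z -
        partialDeriv j (jacobian f) z * partialDeriv i (jacobian f) z) / jacobian f z ^ 2) := by
    intro i j
    rw [← partialDeriv_div (hd j) hJd (hJ z hz)]
    refine partialDeriv_const_mul _ ?_ i
    exact ((hd j).fun_mul (hJd.inv (hJ z hz))).congr_of_eventuallyEq
      (Filter.Eventually.of_forall fun w => div_eq_mul_inv _ _)
  rw [hex, hex, partialDeriv_comm h hs hz i j]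
  ring

end ProjectiveConnection

/-! ### The zeroth order coefficient from the contracted flatness equation. -/

section ProjectiveConnection

variable {n : ℕ}

/-- The contraction of the quadratic curvature term of a connection `S - δ v - δ v` with
trace-free symmetric `S`. -/
lemma sum_sum_connection_mul {S : Fin n → Fin n → Fin n → ℂ} (v : Fin n → ℂ)
    (hsymm : ∀ i j k, S i j k = S j i k) (htr : ∀ i, ∑ k, S i k k = 0) (i j : Fin n) :
    ∑ m, ∑ p, (S i p m - ((if m = i then 1 else 0) * v p + (if m = p then 1 else 0) * v i)) *
        (S m j p - ((if p = m then 1 else 0) * v j + (if p = j then 1 else 0) * v m)) =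
      ∑ m, ∑ p, S i p m * S m j p - 2 * ∑ p, S i j p * v p + ((n : ℂ) + 3) * (v i * v j) := by
  have h1 : ∀ m, ∑ p, (S i p m - ((if m = i then 1 else 0) * v p + (if m = p then 1 else 0) * v i)) *
        (S m j p - ((if p = m then 1 else 0) * v j + (if p = j then 1 else 0) * v m)) =
      ∑ p, S i p m * S m j p - S i m m * v j - S i j m * v m
      + (if m = i then 1 else 0) * (v m * v j + v j * v m - ∑ p, S m j p * v p)
      + v i * v j + (if m = j then 1 else 0) * (v i * v m) - v i * S m j m := by
    intro m
    simp only [mul_sub, sub_mul, mul_add, add_mul, Finset.sum_add_distrib, Finset.sum_sub_distrib]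
    by_cases hmi : m = i <;> by_cases hmj : m = j <;>
      simp [hmi, hmj, Finset.mul_sum, mul_comm] <;> ring
  have h2 : ∑ m, S m j m = 0 := by rw [← htr j]; exact Finset.sum_congr rfl fun m _ => hsymm m j m
  rw [Finset.sum_congr rfl fun m _ => h1 m]
  simp only [Finset.sum_add_distrib, Finset.sum_sub_distrib, ← Finset.mul_sum, ← Finset.sum_mul,
    htr, h2]
  simp
  ring

variable {f : (Fin n → ℂ) → (Fin n → ℂ)} {s : Set (Fin n → ℂ)} {z : Fin n → ℂ}

/-- The zeroth order coefficients are determined by the Schwarzian derivatives. -/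
theorem schwarzianPotential_eq (hs : IsOpen s) (hf : DifferentiableOn ℂ f s)
    (hJ : ∀ z ∈ s, jacobian f z ≠ 0) (hz : z ∈ s) (i j : Fin n) :
    ((n : ℂ) - 1) * schwarzianPotential f i j z =
      ∑ m, ∑ p, schwarzianDeriv f i p m z * schwarzianDeriv f m j p z
        - ∑ m, partialDeriv m (schwarzianDeriv f i j m) z := by
  -- Vanishing of the Ricci contraction. Substituting `Γ = S - δv - δv` makes the derivatives and
  -- squares of `v` combine into `(n - 1) S⁰ᵢⱼ`.
  have hflat : ∑ m, (partialDeriv m (christoffel f i j m) z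
      + ∑ p, christoffel f m p m z * christoffel f i j p z) =
      ∑ m, (partialDeriv i (christoffel f m j m) z
        + ∑ p, christoffel f i p m z * christoffel f m j p z) :=
    Finset.sum_congr rfl fun m _ => christoffel_flat hs hf hJ hz m i j m
  have hG : ∀ i j k, christoffel f i j k z = schwarzianDeriv f i j k z -
      ((if k = i then 1 else 0) * logDerivRootJacobian f j z
        + (if k = j then 1 else 0) * logDerivRootJacobian f i z) := fun i j k => by
    rw [schwarzianDeriv_eq]
    ring
  have hv : ∀ k, DifferentiableAt ℂ (logDerivRootJacobian f k) z := fun k =>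
    (differentiableOn_logDerivRootJacobian hs hf hJ k).differentiableAt (hs.mem_nhds hz)
  have hc : ∀ i j k, DifferentiableAt ℂ (christoffel f i j k) z := fun i j k =>
    (differentiableOn_christoffel hs hf hJ i j k).differentiableAt (hs.mem_nhds hz)
  have hdS : ∀ m, partialDeriv m (schwarzianDeriv f i j m) z =
      partialDeriv m (christoffel f i j m) z
      + ((if m = i then 1 else 0) * partialDeriv m (logDerivRootJacobian f j) z
        + (if m = j then 1 else 0) * partialDeriv m (logDerivRootJacobian f i) z) := by
    intro m
    rw [show schwarzianDeriv f i j m = fun z => _ from funext (schwarzianDeriv_eq f i j m),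
      partialDeriv_add (hc i j m) (((hv j).const_mul _).fun_add ((hv i).const_mul _)),
      partialDeriv_add ((hv j).const_mul _) ((hv i).const_mul _),
      partialDeriv_const_mul _ (hv j), partialDeriv_const_mul _ (hv i)]
  have htr1 : ∀ p, ∑ m, christoffel f m p m z = -((n : ℂ) + 1) * logDerivRootJacobian f p z := by
    intro p
    rw [← sum_christoffel hs hf hJ hz]
    exact Finset.sum_congr rfl fun m _ => christoffel_comm hs hf hz m p m
  have htr2 : ∑ m, partialDeriv i (christoffel f m j m) z =
      -((n : ℂ) + 1) * partialDeriv i (logDerivRootJacobian f j) z := by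
    rw [← partialDeriv_sum (fun m _ => hc m j m), ← partialDeriv_const_mul _ (hv j)]
    refine partialDeriv_congr (Filter.eventually_of_mem (hs.mem_nhds hz) fun w hw => ?_) i
    rw [← sum_christoffel hs hf hJ hw]
    exact Finset.sum_congr rfl fun m _ => christoffel_comm hs hf hw m j m
  have hquad : ∑ m, ∑ p, christoffel f i p m z * christoffel f m j p z =
      ∑ m, ∑ p, schwarzianDeriv f i p m z * schwarzianDeriv f m j p z
        - 2 * ∑ p, schwarzianDeriv f i j p z * logDerivRootJacobian f p z
        + ((n : ℂ) + 3) * (logDerivRootJacobian f i z * logDerivRootJacobian f j z) := by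
    simp only [hG]
    exact sum_sum_connection_mul (S := fun i j k => schwarzianDeriv f i j k z)
      (fun k => logDerivRootJacobian f k z) (fun i j k => schwarzianDeriv_comm hs hf hz i j k)
      (fun i => sum_schwarzianDeriv hs hf hJ hz i) i j
  have hlin : ∑ m, ∑ p, christoffel f m p m z * christoffel f i j p z =
      -((n : ℂ) + 1) * (∑ p, schwarzianDeriv f i j p z * logDerivRootJacobian f p z
        - 2 * (logDerivRootJacobian f i z * logDerivRootJacobian f j z)) := by
    rw [Finset.sum_comm]
    simp only [← Finset.sum_mul, htr1]
    simp only [hG, mul_sub, mul_add, Finset.sum_sub_distrib, Finset.sum_add_distrib,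
      Finset.mul_sum]
    simp
    rw [show (∑ p, (-1 + -(n : ℂ)) * logDerivRootJacobian f p z * schwarzianDeriv f i j p z) =
      ∑ p, (-1 + -(n : ℂ)) * (schwarzianDeriv f i j p z * logDerivRootJacobian f p z) from
        Finset.sum_congr rfl fun p _ => by ring]
    ring
  have hcomm := partialDeriv_logDerivRootJacobian_comm hs hf hJ hz i j
  rw [Finset.sum_add_distrib, Finset.sum_add_distrib, htr2, hquad, hlin] at hflat
  simp only [hdS, Finset.sum_add_distrib]
  simp only [ite_mul, one_mul, zero_mul, Finset.sum_ite_eq', Finset.mem_univ, if_true]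
  rw [schwarzianPotential]
  linear_combination hflat - hcomm

end ProjectiveConnection

/-! ### From the Bergman norm to entrywise bounds, and vanishing of entries. -/

section NormBounds

variable {n : ℕ} {z : Fin n → ℂ}

lemma isOpen_polydisk (n : ℕ) : IsOpen (polydisk n) := by
  have : polydisk n = ⋂ i, {z : Fin n → ℂ | ‖z i‖ < 1} := by ext; simp [polydisk]
  rw [this]
  exact isOpen_iInter_of_finite fun i => isOpen_lt (by fun_prop) continuous_const

lemma one_sub_norm_sq_pos (hz : z ∈ polydisk n) (i : Fin n) : 0 < 1 - ‖z i‖ ^ 2 :=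
  one_sub_sq_pos (norm_nonneg _) (hz i)

lemma update_mem_polydisk (hz : z ∈ polydisk n) (m : Fin n) {w : ℂ} (hw : ‖w‖ < 1) :
    Function.update z m w ∈ polydisk n := by
  intro i
  rcases eq_or_ne i m with rfl | h
  · simpa using hw
  · simpa [h] using hz i

lemma bergmanNorm_nonneg (z v : Fin n → ℂ) : 0 ≤ bergmanNorm z v := Real.sqrt_nonneg _

lemma bergmanNorm_sq (z v : Fin n → ℂ) :
    bergmanNorm z v ^ 2 = 2 * ∑ i, ‖v i‖ ^ 2 / (1 - ‖z i‖ ^ 2) ^ 2 :=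
  Real.sq_sqrt (by positivity)

lemma bergmanNorm_smul (z v : Fin n → ℂ) (c : ℂ) :
    bergmanNorm z (c • v) = ‖c‖ * bergmanNorm z v := by
  rw [bergmanNorm, bergmanNorm, ← Real.sqrt_sq (norm_nonneg c), ← Real.sqrt_mul (sq_nonneg _)]
  congr 1
  simp only [Pi.smul_apply, smul_eq_mul, norm_mul, mul_pow, Finset.mul_sum]
  exact Finset.sum_congr rfl fun i _ => by ring

lemma bergmanNorm_pos (hz : z ∈ polydisk n) {v : Fin n → ℂ} (hv : v ≠ 0) :
    0 < bergmanNorm z v := by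
  obtain ⟨i, hi⟩ := Function.ne_iff.1 hv
  refine Real.sqrt_pos.2 (mul_pos two_pos (Finset.sum_pos' (fun _ _ => by positivity)
    ⟨i, Finset.mem_univ i, ?_⟩))
  have := one_sub_norm_sq_pos hz i
  have := norm_pos_iff.2 hi
  positivity

lemma schwarzianOp_smul (f : (Fin n → ℂ) → (Fin n → ℂ)) (z v : Fin n → ℂ) (c : ℂ) :
    schwarzianOp f z (c • v) = c ^ 2 • schwarzianOp f z v := by
  ext k
  simp only [schwarzianOp, Pi.smul_apply, smul_eq_mul, Finset.mul_sum]
  exact Finset.sum_congr rfl fun i _ => Finset.sum_congr rfl fun j _ => by ring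

variable {f : (Fin n → ℂ) → (Fin n → ℂ)} {α : ℝ}

lemma bergmanNorm_schwarzianOp_le_of_eq_one (hα : schwarzianNorm f ≤ (α : EReal))
    (hz : z ∈ polydisk n) {v : Fin n → ℂ} (hv : bergmanNorm z v = 1) :
    bergmanNorm z (schwarzianOp f z v) ≤ α := by
  rw [← EReal.coe_le_coe_iff]
  refine le_trans ?_ hα
  refine le_trans ?_ (le_iSup₂ (f := fun z (_ : z ∈ polydisk n) => schwarzianNormAt f z) z hz)
  exact le_iSup₂ (f := fun v (_ : bergmanNorm z v = 1) =>
    ((bergmanNorm z (schwarzianOp f z v) : ℝ) : EReal)) v hv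

lemma bergmanNorm_normalize (hz : z ∈ polydisk n) {v : Fin n → ℂ} (hv : v ≠ 0) :
    bergmanNorm z ((((bergmanNorm z v)⁻¹ : ℝ) : ℂ) • v) = 1 := by
  have h := bergmanNorm_pos hz hv
  rw [bergmanNorm_smul, Complex.norm_real, Real.norm_of_nonneg (inv_nonneg.2 h.le),
    inv_mul_cancel₀ h.ne']

lemma nonneg_of_schwarzianNorm_le (hn : 0 < n) (hα : schwarzianNorm f ≤ (α : EReal)) : 0 ≤ α := by
  have h0 : (0 : Fin n → ℂ) ∈ polydisk n := fun i => by simp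
  have h1 : (fun _ => 1 : Fin n → ℂ) ≠ 0 := Function.ne_iff.2 ⟨⟨0, hn⟩, by simp⟩
  exact (bergmanNorm_nonneg _ _).trans
    (bergmanNorm_schwarzianOp_le_of_eq_one hα h0 (bergmanNorm_normalize h0 h1))

lemma sum_norm_schwarzianOp_sq_le (hα : schwarzianNorm f ≤ (α : EReal)) (hz : z ∈ polydisk n)
    (v : Fin n → ℂ) :
    ∑ k, ‖schwarzianOp f z v k‖ ^ 2 / (1 - ‖z k‖ ^ 2) ^ 2 ≤
      2 * α ^ 2 * (∑ i, ‖v i‖ ^ 2 / (1 - ‖z i‖ ^ 2) ^ 2) ^ 2 := by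
  rcases eq_or_ne v 0 with rfl | hv
  · simp [schwarzianOp]
  have hN := bergmanNorm_pos hz hv
  have h1 := bergmanNorm_schwarzianOp_le_of_eq_one hα hz (bergmanNorm_normalize hz hv)
  rw [schwarzianOp_smul, bergmanNorm_smul, norm_pow, Complex.norm_real,
    Real.norm_of_nonneg (inv_nonneg.2 hN.le), inv_pow, inv_mul_le_iff₀ (by positivity)] at h1
  have h2 := pow_le_pow_left₀ (bergmanNorm_nonneg _ _) h1 2
  rw [mul_pow, bergmanNorm_sq, bergmanNorm_sq] at h2
  linarith

/-- Polarization on two coordinates. The case `i = j` is allowed and, with `b = 0`, yields the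
diagonal coefficients. -/
lemma schwarzianOp_single_add_single (hf : DifferentiableOn ℂ f (polydisk n))
    (hz : z ∈ polydisk n) {i j : Fin n} (a b : ℂ) (k : Fin n) :
    schwarzianOp f z (Pi.single i a + Pi.single j b) k =
      a ^ 2 * schwarzianDeriv f i i k z + b ^ 2 * schwarzianDeriv f j j k z
        + 2 * a * b * schwarzianDeriv f i j k z := by
  have h := schwarzianDeriv_comm (isOpen_polydisk n) hf hz i j k
  simp only [schwarzianOp, Pi.add_apply, Pi.single_apply, add_mul, mul_add, ite_mul, mul_ite,
    zero_mul, mul_zero, Finset.sum_add_distrib, Finset.sum_ite_eq', Finset.mem_univ, if_true]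
  rw [← h]
  ring

lemma sum_norm_single_add_single_sq {i j : Fin n} (hij : i ≠ j) (a b : ℂ) :
    ∑ l, ‖(Pi.single i a + Pi.single j b : Fin n → ℂ) l‖ ^ 2 / (1 - ‖z l‖ ^ 2) ^ 2 =
      ‖a‖ ^ 2 / (1 - ‖z i‖ ^ 2) ^ 2 + ‖b‖ ^ 2 / (1 - ‖z j‖ ^ 2) ^ 2 := by
  have h : ∀ l, ‖(Pi.single i a + Pi.single j b : Fin n → ℂ) l‖ ^ 2 / (1 - ‖z l‖ ^ 2) ^ 2 =
      (if l = i then ‖a‖ ^ 2 / (1 - ‖z l‖ ^ 2) ^ 2 else 0) +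
      (if l = j then ‖b‖ ^ 2 / (1 - ‖z l‖ ^ 2) ^ 2 else 0) := by
    intro l
    by_cases h1 : l = i
    · have h2 : l ≠ j := fun h => hij (h1.symm.trans h)
      simp [h1, hij]
    · simp [Pi.single_apply, h1]
      split_ifs <;> simp
  simp only [h, Finset.sum_add_distrib]
  simp

/-- The parallelogram identity applied to the Schwarzian quadratic form. -/
lemma sum_norm_schwarzianDeriv_sq_le (hf : DifferentiableOn ℂ f (polydisk n))
    (hα : schwarzianNorm f ≤ (α : EReal)) (hz : z ∈ polydisk n) {i j : Fin n} (hij : i ≠ j) :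
    ∑ k, (‖((1 - ‖z i‖ ^ 2 : ℝ) : ℂ) ^ 2 * schwarzianDeriv f i i k z
          + ((1 - ‖z j‖ ^ 2 : ℝ) : ℂ) ^ 2 * schwarzianDeriv f j j k z‖ ^ 2
        + (2 * ((1 - ‖z i‖ ^ 2) * (1 - ‖z j‖ ^ 2)) * ‖schwarzianDeriv f i j k z‖) ^ 2)
        / (1 - ‖z k‖ ^ 2) ^ 2 ≤ 8 * α ^ 2 := by
  -- With these entries each of the two coordinates contributes exactly `1` to the weighted sum.
  -- Averaging over the sign of `b` separates the mixed coefficient from the diagonal ones.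
  set a : ℂ := ((1 - ‖z i‖ ^ 2 : ℝ) : ℂ) with ha
  set b : ℂ := ((1 - ‖z j‖ ^ 2 : ℝ) : ℂ) with hb
  have hi := one_sub_norm_sq_pos hz i
  have hj := one_sub_norm_sq_pos hz j
  have hna : ‖a‖ = 1 - ‖z i‖ ^ 2 := by rw [ha, Complex.norm_real, Real.norm_of_nonneg hi.le]
  have hnb : ‖b‖ = 1 - ‖z j‖ ^ 2 := by rw [hb, Complex.norm_real, Real.norm_of_nonneg hj.le]
  have h1 := sum_norm_schwarzianOp_sq_le hα hz (Pi.single i a + Pi.single j b)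
  have h2 := sum_norm_schwarzianOp_sq_le hα hz (Pi.single i a + Pi.single j (-b))
  rw [sum_norm_single_add_single_sq hij] at h1 h2
  rw [norm_neg] at h2
  rw [hna, hnb, div_self (by positivity), div_self (by positivity)] at h1 h2
  simp only [schwarzianOp_single_add_single hf hz] at h1 h2
  have h3 : ∀ k, (‖a ^ 2 * schwarzianDeriv f i i k z + b ^ 2 * schwarzianDeriv f j j k z‖ ^ 2
        + (2 * ((1 - ‖z i‖ ^ 2) * (1 - ‖z j‖ ^ 2)) * ‖schwarzianDeriv f i j k z‖) ^ 2)
        / (1 - ‖z k‖ ^ 2) ^ 2 =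
      (‖a ^ 2 * schwarzianDeriv f i i k z + b ^ 2 * schwarzianDeriv f j j k z
        + 2 * a * b * schwarzianDeriv f i j k z‖ ^ 2 / (1 - ‖z k‖ ^ 2) ^ 2 +
      ‖a ^ 2 * schwarzianDeriv f i i k z + (-b) ^ 2 * schwarzianDeriv f j j k z
        + 2 * a * (-b) * schwarzianDeriv f i j k z‖ ^ 2 / (1 - ‖z k‖ ^ 2) ^ 2) / 2 := by
    intro k
    have h4 : 2 * ((1 - ‖z i‖ ^ 2) * (1 - ‖z j‖ ^ 2)) * ‖schwarzianDeriv f i j k z‖ =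
        ‖2 * a * b * schwarzianDeriv f i j k z‖ := by
      rw [norm_mul, norm_mul, norm_mul, hna, hnb, Complex.norm_ofNat]
      ring
    have h5 := parallelogram_law_with_norm ℂ
      (a ^ 2 * schwarzianDeriv f i i k z + b ^ 2 * schwarzianDeriv f j j k z)
      (2 * a * b * schwarzianDeriv f i j k z)
    rw [h4, neg_sq, mul_neg, neg_mul, ← sub_eq_add_neg, ← add_div, div_right_comm]
    congr 1
    linarith
  simp only [h3, ← Finset.sum_div, Finset.sum_add_distrib]
  linarith

/-- The entrywise bound on the Schwarzian derivatives. -/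
theorem norm_schwarzianDeriv_le (hf : DifferentiableOn ℂ f (polydisk n)) (hn : 0 < n)
    (hα : schwarzianNorm f ≤ (α : EReal)) (hz : z ∈ polydisk n) (i j k : Fin n) :
    ‖schwarzianDeriv f i j k z‖ * ((1 - ‖z i‖ ^ 2) * (1 - ‖z j‖ ^ 2)) ≤
      √2 * α * (1 - ‖z k‖ ^ 2) := by
  have hα0 := nonneg_of_schwarzianNorm_le hn hα
  have hi := one_sub_norm_sq_pos hz i
  have hj := one_sub_norm_sq_pos hz j
  have hk := one_sub_norm_sq_pos hz k
  have h2 : √2 ^ 2 = 2 := Real.sq_sqrt (by norm_num)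
  refine (pow_le_pow_iff_left₀ (by positivity) (by positivity) two_ne_zero).1 ?_
  rcases eq_or_ne i j with rfl | hij
  · set a : ℂ := ((1 - ‖z i‖ ^ 2 : ℝ) : ℂ) with ha
    have hna : ‖a‖ = 1 - ‖z i‖ ^ 2 := by rw [ha, Complex.norm_real, Real.norm_of_nonneg hi.le]
    have h1 := sum_norm_schwarzianOp_sq_le hα hz (Pi.single i a + Pi.single i 0)
    have h3 : ∑ l, ‖(Pi.single i a + Pi.single i 0 : Fin n → ℂ) l‖ ^ 2 / (1 - ‖z l‖ ^ 2) ^ 2 = 1 := by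
      rw [Finset.sum_eq_single i]
      · simp only [Pi.single_zero, add_zero, Pi.single_eq_same, hna]
        exact div_self (by positivity)
      · intro l _ hl
        simp [hl]
      · simp
    rw [h3] at h1
    have h4 := (Finset.single_le_sum (fun l _ => by positivity) (Finset.mem_univ k)).trans h1
    rw [schwarzianOp_single_add_single hf hz, div_le_iff₀ (by positivity)] at h4
    simp only [ne_eq, OfNat.ofNat_ne_zero, not_false_eq_true, zero_pow, zero_mul, add_zero,
      mul_zero, norm_mul, norm_pow, hna] at h4
    rw [mul_pow, mul_pow (√2 * α), mul_pow √2, h2]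
    nlinarith
  · have h1 := sum_norm_schwarzianDeriv_sq_le hf hα hz hij
    have h4 := (Finset.single_le_sum (fun l _ => by positivity) (Finset.mem_univ k)).trans h1
    rw [div_le_iff₀ (by positivity)] at h4
    rw [mul_pow (√2 * α), mul_pow √2, h2]
    nlinarith [sq_nonneg ‖((1 - ‖z i‖ ^ 2 : ℝ) : ℂ) ^ 2 * schwarzianDeriv f i i k z
          + ((1 - ‖z j‖ ^ 2 : ℝ) : ℂ) ^ 2 * schwarzianDeriv f j j k z‖]

section Slices

variable {b : ℝ}

lemma differentiableOn_slice {F : (Fin n → ℂ) → ℂ} (hF : DifferentiableOn ℂ F (polydisk n))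
    (hz : z ∈ polydisk n) (m : Fin n) :
    DifferentiableOn ℂ (fun w => F (Function.update z m w)) (Metric.ball 0 1) := by
  intro w hw
  exact (hasDerivAt_comp_update (hF.differentiableAt ((isOpen_polydisk n).mem_nhds
    (update_mem_polydisk hz m (by simpa using hw))))).differentiableAt.differentiableWithinAt

lemma deriv_slice {F : (Fin n → ℂ) → ℂ} (hF : DifferentiableOn ℂ F (polydisk n))
    (hz : z ∈ polydisk n) (m : Fin n) :
    deriv (fun w => F (Function.update z m w)) (z m) = partialDeriv m F z := by
  have h := hasDerivAt_comp_update (z := z) (w := z m) (m := m) (hF.differentiableAt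
    ((isOpen_polydisk n).mem_nhds (update_mem_polydisk hz m (hz m))))
  rw [h.deriv, Function.update_eq_self]

/-- The entrywise bound forces all entries with an isolated upper index to vanish. -/
theorem schwarzianDeriv_eq_zero_of_ne
    (hS : ∀ i j k, DifferentiableOn ℂ (schwarzianDeriv f i j k) (polydisk n))
    (hb : ∀ z ∈ polydisk n, ∀ i j k,
      ‖schwarzianDeriv f i j k z‖ * ((1 - ‖z i‖ ^ 2) * (1 - ‖z j‖ ^ 2)) ≤ b * (1 - ‖z k‖ ^ 2))
    (hz : z ∈ polydisk n) {i j k : Fin n} (hki : k ≠ i) (hkj : k ≠ j) :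
    schwarzianDeriv f i j k z = 0 := by
  have hi := one_sub_norm_sq_pos hz i
  have hj := one_sub_norm_sq_pos hz j
  -- As a function of the `k`-th coordinate alone the entry is `O(1 - |w|²)`, since the weights of
  -- `i` and `j` stay fixed.
  have h := eq_zero_of_norm_le_one_sub_sq (z := z k)
    (C := b / ((1 - ‖z i‖ ^ 2) * (1 - ‖z j‖ ^ 2))) (differentiableOn_slice (hS i j k) hz k)
    (fun w hw => by
      have := hb _ (update_mem_polydisk hz k hw) i j k
      simp only [Function.update_self, Function.update_of_ne hki.symm,
        Function.update_of_ne hkj.symm] at this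
      rw [div_mul_eq_mul_div, le_div_iff₀ (by positivity)]
      exact this) (hz k)
  simpa using h

/-- One weight cancels, leaving a bound `b / (1 - |w|²)` in the variable `w = zᵢ`. It may blow up at
the boundary, whence the constant `10/3`. -/
lemma norm_partialDeriv_schwarzianDeriv_diag_le
    (hS : ∀ i j k, DifferentiableOn ℂ (schwarzianDeriv f i j k) (polydisk n))
    (hb : ∀ z ∈ polydisk n, ∀ i j k,
      ‖schwarzianDeriv f i j k z‖ * ((1 - ‖z i‖ ^ 2) * (1 - ‖z j‖ ^ 2)) ≤ b * (1 - ‖z k‖ ^ 2))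
    (hz : z ∈ polydisk n) (i : Fin n) :
    ‖partialDeriv i (schwarzianDeriv f i i i) z‖ ≤ 10 / 3 * b / (1 - ‖z i‖ ^ 2) ^ 2 := by
  rw [← deriv_slice (hS i i i) hz]
  refine norm_deriv_le_of_norm_le_div_one_sub_sq (differentiableOn_slice (hS i i i) hz i)
    (fun w hw => ?_) (hz i)
  have h := hb _ (update_mem_polydisk hz i hw) i i i
  have hw' := one_sub_sq_pos (norm_nonneg w) hw
  simp only [Function.update_self] at h
  rw [← mul_assoc] at h
  rw [le_div_iff₀ hw']
  exact le_of_mul_le_mul_right h hw'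

/-- Here the weight of `zᵢ` cancels completely, so the entry is bounded in `zᵢ` and Schwarz-Pick
applies with constant `1`. -/
lemma norm_partialDeriv_schwarzianDeriv_offDiag_le
    (hS : ∀ i j k, DifferentiableOn ℂ (schwarzianDeriv f i j k) (polydisk n))
    (hb : ∀ z ∈ polydisk n, ∀ i j k,
      ‖schwarzianDeriv f i j k z‖ * ((1 - ‖z i‖ ^ 2) * (1 - ‖z j‖ ^ 2)) ≤ b * (1 - ‖z k‖ ^ 2))
    (hz : z ∈ polydisk n) {i j : Fin n} (hij : i ≠ j) :
    ‖partialDeriv i (schwarzianDeriv f i j i) z‖ ≤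
      b / ((1 - ‖z i‖ ^ 2) * (1 - ‖z j‖ ^ 2)) := by
  have hj := one_sub_norm_sq_pos hz j
  rw [← deriv_slice (hS i j i) hz, mul_comm, ← div_div]
  refine norm_deriv_le_of_norm_le_unitDisc (differentiableOn_slice (hS i j i) hz i)
    (fun w hw => ?_) (hz i)
  have h := hb _ (update_mem_polydisk hz i hw) i j i
  have hw' := one_sub_sq_pos (norm_nonneg w) hw
  simp only [Function.update_self, Function.update_of_ne hij.symm] at h
  rw [mul_comm (1 - ‖w‖ ^ 2), ← mul_assoc] at h
  rw [le_div_iff₀ hj]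
  exact le_of_mul_le_mul_right h hw'

end Slices

end NormBounds

/-! ### Bounds for the sums of the coefficients of the linear system. -/

section CoefficientSums

variable {n : ℕ} {f : (Fin n → ℂ) → (Fin n → ℂ)} {z : Fin n → ℂ} {b ω : ℝ}

lemma norm_schwarzianDeriv_le_div
    (hb : ∀ z ∈ polydisk n, ∀ i j k,
      ‖schwarzianDeriv f i j k z‖ * ((1 - ‖z i‖ ^ 2) * (1 - ‖z j‖ ^ 2)) ≤ b * (1 - ‖z k‖ ^ 2))
    (hz : z ∈ polydisk n) (i j k : Fin n) :
    ‖schwarzianDeriv f i j k z‖ ≤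
      b * (1 - ‖z k‖ ^ 2) / ((1 - ‖z i‖ ^ 2) * (1 - ‖z j‖ ^ 2)) := by
  have hi := one_sub_norm_sq_pos hz i
  have hj := one_sub_norm_sq_pos hz j
  rw [le_div_iff₀ (by positivity)]
  exact hb z hz i j k

lemma nonneg_of_norm_schwarzianDeriv_le (hn : 0 < n)
    (hb : ∀ z ∈ polydisk n, ∀ i j k,
      ‖schwarzianDeriv f i j k z‖ * ((1 - ‖z i‖ ^ 2) * (1 - ‖z j‖ ^ 2)) ≤ b * (1 - ‖z k‖ ^ 2)) :
    0 ≤ b := by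
  have h := hb 0 (fun i => by simp) ⟨0, hn⟩ ⟨0, hn⟩ ⟨0, hn⟩
  simp at h
  exact (norm_nonneg _).trans h

/-- Only the `2n - 1` pairs `(i, j)` containing `k` survive, and in each of them the weight of `k`
cancels. -/
lemma sum_norm_schwarzianDeriv_le (hn : 0 < n)
    (hS : ∀ i j k, DifferentiableOn ℂ (schwarzianDeriv f i j k) (polydisk n))
    (hb : ∀ z ∈ polydisk n, ∀ i j k,
      ‖schwarzianDeriv f i j k z‖ * ((1 - ‖z i‖ ^ 2) * (1 - ‖z j‖ ^ 2)) ≤ b * (1 - ‖z k‖ ^ 2))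
    (hz : z ∈ polydisk n) (hω : 0 < ω) (hωz : ∀ i, ω ≤ 1 - ‖z i‖ ^ 2) (k : Fin n) :
    ∑ i, ∑ j, ‖schwarzianDeriv f i j k z‖ ≤ (2 * n - 1) * b / ω := by
  have hb0 := nonneg_of_norm_schwarzianDeriv_le hn hb
  have hk := one_sub_norm_sq_pos hz k
  have hterm : ∀ i j, ‖schwarzianDeriv f i j k z‖ ≤ (if i = k then b / ω else 0) +
      (if j = k then b / ω else 0) - (if i = k then (if j = k then b / ω else 0) else 0) := by
    intro i j
    have h := norm_schwarzianDeriv_le_div hb hz i j k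
    have hi := one_sub_norm_sq_pos hz i
    have hj := one_sub_norm_sq_pos hz j
    by_cases hik : i = k
    · subst hik
      have h2 : ‖schwarzianDeriv f i j i z‖ ≤ b / ω := by
        refine h.trans ?_
        rw [mul_comm b, mul_div_mul_left _ _ hi.ne']
        exact div_le_div_of_nonneg_left hb0 hω (hωz j)
      simpa using h2
    · by_cases hjk : j = k
      · subst hjk
        have h2 : ‖schwarzianDeriv f i j j z‖ ≤ b / ω := by
          refine h.trans ?_
          rw [mul_div_mul_right _ _ hj.ne']
          exact div_le_div_of_nonneg_left hb0 hω (hωz i)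
        simpa [hik] using h2
      · rw [schwarzianDeriv_eq_zero_of_ne hS hb hz (Ne.symm hik) (Ne.symm hjk)]
        simp [hik, hjk]
  refine (Finset.sum_le_sum fun i _ => Finset.sum_le_sum fun j _ => hterm i j).trans_eq ?_
  simp [Finset.sum_add_distrib, Finset.sum_sub_distrib]
  ring

/-- The vanishing of entries leaves few terms in `schwarzianPotential_eq`. Compared with `i ≠ j`,
the diagonal case has one quadratic term fewer but the costlier derivative bound: `10/3 b` in place
of `b + b`. -/
lemma norm_schwarzianPotential_le (hn : 2 ≤ n)
    (hf : DifferentiableOn ℂ f (polydisk n)) (hJ : ∀ z ∈ polydisk n, jacobian f z ≠ 0)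
    (hb : ∀ z ∈ polydisk n, ∀ i j k,
      ‖schwarzianDeriv f i j k z‖ * ((1 - ‖z i‖ ^ 2) * (1 - ‖z j‖ ^ 2)) ≤ b * (1 - ‖z k‖ ^ 2))
    (hz : z ∈ polydisk n) (hω : 0 < ω) (hωz : ∀ i, ω ≤ 1 - ‖z i‖ ^ 2) (i j : Fin n) :
    ((n : ℝ) - 1) * ‖schwarzianPotential f i j z‖ ≤
      ((n * b ^ 2 + b ^ 2 + 2 * b) + (if i = j then 4 / 3 * b - b ^ 2 else 0)) / ω ^ 2 := by
  have hopen := isOpen_polydisk n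
  have hS : ∀ i j k, DifferentiableOn ℂ (schwarzianDeriv f i j k) (polydisk n) :=
    differentiableOn_schwarzianDeriv hopen hf hJ
  have hb0 := nonneg_of_norm_schwarzianDeriv_le (by omega) hb
  have hω2 : ∀ i j, ω ^ 2 ≤ (1 - ‖z i‖ ^ 2) * (1 - ‖z j‖ ^ 2) := fun i j => by
    rw [sq]
    exact mul_le_mul (hωz i) (hωz j) hω.le (hω.le.trans (hωz i))
  -- A nonzero product needs `m ∈ {i, p}` and `p ∈ {m, j}`: either `m = p`, or `m = i` and `p = j`.
  -- The second adds a new pair only if `i ≠ j`.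
  have hquad : ∀ m p, ‖schwarzianDeriv f i p m z‖ * ‖schwarzianDeriv f m j p z‖ ≤
      (if m = p then b ^ 2 / ω ^ 2 else 0) + (if m = i then (if p = j then
        (if i = j then 0 else b ^ 2 / ω ^ 2) else 0) else 0) := by
    intro m p
    have hi := one_sub_norm_sq_pos hz i
    have hj := one_sub_norm_sq_pos hz j
    have hm := one_sub_norm_sq_pos hz m
    have hp := one_sub_norm_sq_pos hz p
    have h0 : 0 ≤ b ^ 2 / ω ^ 2 := by positivity
    have hle : ‖schwarzianDeriv f i p m z‖ * ‖schwarzianDeriv f m j p z‖ ≤ b ^ 2 / ω ^ 2 := by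
      calc _ ≤ b * (1 - ‖z m‖ ^ 2) / ((1 - ‖z i‖ ^ 2) * (1 - ‖z p‖ ^ 2)) *
            (b * (1 - ‖z p‖ ^ 2) / ((1 - ‖z m‖ ^ 2) * (1 - ‖z j‖ ^ 2))) :=
            mul_le_mul (norm_schwarzianDeriv_le_div hb hz i p m)
              (norm_schwarzianDeriv_le_div hb hz m j p) (norm_nonneg _) (by positivity)
        _ = b ^ 2 / ((1 - ‖z i‖ ^ 2) * (1 - ‖z j‖ ^ 2)) := by field_simp
        _ ≤ b ^ 2 / ω ^ 2 := div_le_div_of_nonneg_left (by positivity) (by positivity) (hω2 i j)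
    by_cases hmp : m = p
    · rw [if_pos hmp]
      refine hle.trans (le_add_of_nonneg_right ?_)
      split_ifs <;> positivity
    · by_cases hmi : m = i
      · by_cases hpj : p = j
        · have hij : i ≠ j := fun h => hmp (by rw [hmi, hpj, h])
          simpa [hmp, hmi, hpj, hij] using hle
        · rw [schwarzianDeriv_eq_zero_of_ne hS hb hz (Ne.symm hmp) hpj]
          simp [hmp, hpj]
      · rw [schwarzianDeriv_eq_zero_of_ne hS hb hz hmi hmp]
        simp [hmp, hmi]
  have hdiv0 : ∀ m, m ≠ i → m ≠ j → partialDeriv m (schwarzianDeriv f i j m) z = 0 := by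
    intro m hmi hmj
    have : schwarzianDeriv f i j m =ᶠ[nhds z] fun _ => 0 :=
      Filter.eventually_of_mem (hopen.mem_nhds hz) fun w hw =>
        schwarzianDeriv_eq_zero_of_ne hS hb hw hmi hmj
    rw [partialDeriv_congr this, partialDeriv_const]
  have hdiag : ∀ i, ‖partialDeriv i (schwarzianDeriv f i i i) z‖ ≤ 10 / 3 * b / ω ^ 2 := fun i =>
    (norm_partialDeriv_schwarzianDeriv_diag_le hS hb hz i).trans
      (div_le_div_of_nonneg_left (by positivity) (by positivity)
        ((hω2 i i).trans_eq (sq (1 - ‖z i‖ ^ 2)).symm))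
  have hoff : ∀ i j, i ≠ j → ‖partialDeriv i (schwarzianDeriv f i j i) z‖ ≤ b / ω ^ 2 :=
    fun i j hij => (norm_partialDeriv_schwarzianDeriv_offDiag_le hS hb hz hij).trans
      (div_le_div_of_nonneg_left hb0 (by positivity) (hω2 i j))
  have hdiv : ‖∑ m, partialDeriv m (schwarzianDeriv f i j m) z‖ ≤
      (2 * b + if i = j then 4 / 3 * b else 0) / ω ^ 2 := by
    by_cases hij : i = j
    · subst hij
      rw [Finset.sum_eq_single i (fun m _ hm => hdiv0 m hm hm) (by simp), if_pos rfl]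
      refine (hdiag i).trans_eq ?_
      ring
    · rw [Finset.sum_eq_add i j hij (fun m _ hm => hdiv0 m hm.1 hm.2) (by simp) (by simp),
        if_neg hij]
      refine (norm_add_le _ _).trans ((add_le_add (hoff i j hij) ?_).trans_eq
        (b := b / ω ^ 2 + b / ω ^ 2) (by ring))
      have hcomm : schwarzianDeriv f i j j =ᶠ[nhds z] schwarzianDeriv f j i j :=
        Filter.eventually_of_mem (hopen.mem_nhds hz) fun w hw =>
          schwarzianDeriv_comm hopen hf hw i j j
      rw [partialDeriv_congr hcomm]
      exact hoff j i (Ne.symm hij)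
  have hn1 : ((n : ℝ) - 1) = ‖(n : ℂ) - 1‖ := by
    have : ((n : ℂ) - 1) = (((n : ℝ) - 1 : ℝ) : ℂ) := by push_cast; rfl
    rw [this, Complex.norm_real, Real.norm_of_nonneg]
    have : (2 : ℝ) ≤ n := by exact_mod_cast hn
    linarith
  rw [hn1, ← norm_mul, schwarzianPotential_eq hopen hf hJ hz]
  refine (norm_sub_le _ _).trans ?_
  have hsum : ‖∑ m, ∑ p, schwarzianDeriv f i p m z * schwarzianDeriv f m j p z‖ ≤
      n * (b ^ 2 / ω ^ 2) + if i = j then 0 else b ^ 2 / ω ^ 2 := by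
    refine (norm_sum_le _ _).trans ((Finset.sum_le_sum fun m _ => (norm_sum_le _ _).trans
      (Finset.sum_le_sum fun p _ => (norm_mul_le _ _).trans (hquad m p))).trans_eq ?_)
    simp [Finset.sum_add_distrib]
  refine (add_le_add hsum hdiv).trans_eq ?_
  split_ifs <;> ring

lemma sum_norm_schwarzianPotential_le (hn : 2 ≤ n)
    (hf : DifferentiableOn ℂ f (polydisk n)) (hJ : ∀ z ∈ polydisk n, jacobian f z ≠ 0)
    (hb : ∀ z ∈ polydisk n, ∀ i j k,
      ‖schwarzianDeriv f i j k z‖ * ((1 - ‖z i‖ ^ 2) * (1 - ‖z j‖ ^ 2)) ≤ b * (1 - ‖z k‖ ^ 2))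
    (hz : z ∈ polydisk n) (hω : 0 < ω) (hωz : ∀ i, ω ≤ 1 - ‖z i‖ ^ 2) :
    ∑ i, ∑ j, ‖schwarzianPotential f i j z‖ ≤
      (n ^ 2 * (n * b ^ 2 + b ^ 2 + 2 * b) + n * (4 / 3 * b - b ^ 2)) / (n - 1) / ω ^ 2 := by
  have hn1 : (0 : ℝ) < n - 1 := by
    have : (2 : ℝ) ≤ n := by exact_mod_cast hn
    linarith
  rw [div_right_comm, le_div_iff₀ hn1, mul_comm, Finset.mul_sum]
  simp only [Finset.mul_sum]
  refine (Finset.sum_le_sum fun i _ => Finset.sum_le_sum fun j _ =>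
    norm_schwarzianPotential_le hn hf hJ hb hz hω hωz i j).trans_eq ?_
  simp only [← Finset.sum_div, Finset.sum_add_distrib]
  simp
  ring

end CoefficientSums

/-! ### Numerical constants for the Riccati comparison. -/

section Constants

/-- In two variables the entries of the Schwarzian derivative satisfy a joint quadratic bound. -/
lemma norm_schwarzianDeriv_sq_add_sq_le {f : (Fin 2 → ℂ) → (Fin 2 → ℂ)} {α : ℝ}
    (hf : DifferentiableOn ℂ f (polydisk 2)) (hJ : ∀ z ∈ polydisk 2, jacobian f z ≠ 0)
    (hα : schwarzianNorm f ≤ (α : EReal)) {z : Fin 2 → ℂ} (hz : z ∈ polydisk 2) :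
    5 * ((‖schwarzianDeriv f 0 0 0 z‖ * (1 - ‖z 0‖ ^ 2)) ^ 2 +
      (‖schwarzianDeriv f 1 1 1 z‖ * (1 - ‖z 1‖ ^ 2)) ^ 2) ≤ 8 * α ^ 2 ∧
    schwarzianDeriv f 0 0 1 z = 0 ∧ schwarzianDeriv f 1 1 0 z = 0 ∧
    schwarzianDeriv f 0 1 1 z = -schwarzianDeriv f 0 0 0 z ∧
    schwarzianDeriv f 0 1 0 z = -schwarzianDeriv f 1 1 1 z := by
  have hopen := isOpen_polydisk 2
  have hS : ∀ i j k, DifferentiableOn ℂ (schwarzianDeriv f i j k) (polydisk 2) :=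
    differentiableOn_schwarzianDeriv hopen hf hJ
  have hb : ∀ z ∈ polydisk 2, ∀ i j k, _ := fun z hz i j k =>
    norm_schwarzianDeriv_le hf two_pos hα hz i j k
  have h001 := schwarzianDeriv_eq_zero_of_ne hS hb hz (i := 0) (j := 0) (k := 1) (by simp) (by simp)
  have h110 := schwarzianDeriv_eq_zero_of_ne hS hb hz (i := 1) (j := 1) (k := 0) (by simp) (by simp)
  have ht0 := sum_schwarzianDeriv hopen hf hJ hz 0
  have ht1 := sum_schwarzianDeriv hopen hf hJ hz 1
  rw [Fin.sum_univ_two] at ht0 ht1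
  rw [schwarzianDeriv_comm hopen hf hz 1 0 0] at ht1
  have h011 : schwarzianDeriv f 0 1 1 z = -schwarzianDeriv f 0 0 0 z := by linear_combination ht0
  have h010 : schwarzianDeriv f 0 1 0 z = -schwarzianDeriv f 1 1 1 z := by linear_combination ht1
  refine ⟨?_, h001, h110, h011, h010⟩
  have h0 := one_sub_norm_sq_pos hz 0
  have h1 := one_sub_norm_sq_pos hz 1
  have h := sum_norm_schwarzianDeriv_sq_le hf hα hz (i := 0) (j := 1) (by simp)
  -- Trace-freeness leaves only `A = |S⁰₀₀| (1 - |z₀|²)` and `B = |S¹₁₁| (1 - |z₁|²)`; the two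
  -- components contribute `A² + 4B²` and `B² + 4A²`.
  rw [Fin.sum_univ_two, h001, h110, h011, h010] at h
  simp only [mul_zero, add_zero, zero_add, norm_mul, norm_neg, norm_pow, Complex.norm_real,
    Real.norm_of_nonneg h0.le, Real.norm_of_nonneg h1.le] at h
  refine le_trans (le_of_eq ?_) h
  field_simp
  ring

section TwoVariables

variable {f : (Fin 2 → ℂ) → (Fin 2 → ℂ)} {α : ℝ} {z : Fin 2 → ℂ}

/-- The joint quadratic bound improves the general constant `√2` to `√(8/5)`. -/
lemma norm_schwarzianDeriv_le_two (hf : DifferentiableOn ℂ f (polydisk 2))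
    (hJ : ∀ z ∈ polydisk 2, jacobian f z ≠ 0) (hα : schwarzianNorm f ≤ (α : EReal))
    (hz : z ∈ polydisk 2) (i j k : Fin 2) :
    ‖schwarzianDeriv f i j k z‖ * ((1 - ‖z i‖ ^ 2) * (1 - ‖z j‖ ^ 2)) ≤
      √(8 / 5 : ℝ) * α * (1 - ‖z k‖ ^ 2) := by
  have hα0 := nonneg_of_schwarzianNorm_le two_pos hα
  have h85 : √(8 / 5 : ℝ) ^ 2 = 8 / 5 := Real.sq_sqrt (by norm_num)
  obtain ⟨h, h001, h110, h011, h010⟩ := norm_schwarzianDeriv_sq_add_sq_le hf hJ hα hz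
  have h0 := one_sub_norm_sq_pos hz 0
  have h1 := one_sub_norm_sq_pos hz 1
  have h101 := schwarzianDeriv_comm (isOpen_polydisk 2) hf hz 1 0 1
  have h100 := schwarzianDeriv_comm (isOpen_polydisk 2) hf hz 1 0 0
  set b := √(8 / 5 : ℝ) * α with hb
  have hb0 : 0 ≤ b := by positivity
  have hbsq : b ^ 2 = 8 / 5 * α ^ 2 := by rw [hb, mul_pow, h85]
  have hA : ‖schwarzianDeriv f 0 0 0 z‖ * (1 - ‖z 0‖ ^ 2) ≤ b := by
    refine (pow_le_pow_iff_left₀ (by positivity) hb0 two_ne_zero).1 ?_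
    linarith [sq_nonneg (‖schwarzianDeriv f 1 1 1 z‖ * (1 - ‖z 1‖ ^ 2))]
  have hB : ‖schwarzianDeriv f 1 1 1 z‖ * (1 - ‖z 1‖ ^ 2) ≤ b := by
    refine (pow_le_pow_iff_left₀ (by positivity) hb0 two_ne_zero).1 ?_
    linarith [sq_nonneg (‖schwarzianDeriv f 0 0 0 z‖ * (1 - ‖z 0‖ ^ 2))]
  have h2 : ∀ l : Fin 2, l = 0 ∨ l = 1 := by omega
  rcases h2 i with rfl | rfl <;> rcases h2 j with rfl | rfl <;> rcases h2 k with rfl | rfl <;>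
    try simp only [h101, h100, h001, h110, h011, h010, norm_neg, norm_zero, zero_mul] <;>
    generalize 1 - ‖z 0‖ ^ 2 = x at * <;> generalize 1 - ‖z 1‖ ^ 2 = y at *
  · linarith [mul_le_mul_of_nonneg_right hA h0.le]
  · positivity
  · linarith [mul_le_mul_of_nonneg_right hB h0.le]
  · linarith [mul_le_mul_of_nonneg_right hA h1.le]
  · linarith [mul_le_mul_of_nonneg_right hB h0.le]
  · linarith [mul_le_mul_of_nonneg_right hA h1.le]
  · positivity
  · linarith [mul_le_mul_of_nonneg_right hB h1.le]

/-- Each sum has the form `A + 2B` or `B + 2A`, so Cauchy-Schwarz with `1² + 2² = 5` matches the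
factor `5` of the joint bound. -/
lemma sum_norm_schwarzianDeriv_le_two (hf : DifferentiableOn ℂ f (polydisk 2))
    (hJ : ∀ z ∈ polydisk 2, jacobian f z ≠ 0) (hα : schwarzianNorm f ≤ (α : EReal))
    (hz : z ∈ polydisk 2) {ω : ℝ} (hω : 0 < ω) (hωz : ∀ i, ω ≤ 1 - ‖z i‖ ^ 2) (k : Fin 2) :
    ∑ i, ∑ j, ‖schwarzianDeriv f i j k z‖ ≤ 2 * √2 * α / ω := by
  have hα0 := nonneg_of_schwarzianNorm_le two_pos hα
  have h2 : √(2 : ℝ) ^ 2 = 2 := Real.sq_sqrt (by norm_num)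
  obtain ⟨h, h001, h110, h011, h010⟩ := norm_schwarzianDeriv_sq_add_sq_le hf hJ hα hz
  have h101 := schwarzianDeriv_comm (isOpen_polydisk 2) hf hz 1 0 1
  have h100 := schwarzianDeriv_comm (isOpen_polydisk 2) hf hz 1 0 0
  have hA0 : 0 ≤ ‖schwarzianDeriv f 0 0 0 z‖ := norm_nonneg _
  have hB0 : 0 ≤ ‖schwarzianDeriv f 1 1 1 z‖ := norm_nonneg _
  have hAω2 := pow_le_pow_left₀ (by positivity) (mul_le_mul_of_nonneg_left (hωz 0) hA0) 2
  have hBω2 := pow_le_pow_left₀ (by positivity) (mul_le_mul_of_nonneg_left (hωz 1) hB0) 2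
  have hc2 : (2 * √2 * α) ^ 2 = 8 * α ^ 2 := by rw [mul_pow, mul_pow, h2]; ring
  have hsq : 5 * ((‖schwarzianDeriv f 0 0 0 z‖ * ω) ^ 2 +
      (‖schwarzianDeriv f 1 1 1 z‖ * ω) ^ 2) ≤ (2 * √2 * α) ^ 2 := by linarith
  rw [le_div_iff₀ hω]
  have hc0 : 0 ≤ 2 * √2 * α := by positivity
  refine le_of_abs_le (abs_le_of_sq_le_sq (le_trans ?_ hsq) hc0)
  have hk : k = 0 ∨ k = 1 := by omega
  rcases hk with rfl | rfl
  · rw [Fin.sum_univ_two, Fin.sum_univ_two, Fin.sum_univ_two, h100, h110, h010, norm_neg, norm_zero]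
    nlinarith [sq_nonneg (2 * (‖schwarzianDeriv f 0 0 0 z‖ * ω) - ‖schwarzianDeriv f 1 1 1 z‖ * ω)]
  · rw [Fin.sum_univ_two, Fin.sum_univ_two, Fin.sum_univ_two, h101, h001, h011, norm_neg, norm_zero]
    nlinarith [sq_nonneg (‖schwarzianDeriv f 0 0 0 z‖ * ω - 2 * (‖schwarzianDeriv f 1 1 1 z‖ * ω))]

end TwoVariables

/-- The sums of the coefficients of the linear system for `J_f ^ (-1 / (n + 1))` are bounded by
constants for which a Riccati comparison on rays applies. -/
theorem exists_coefficient_bounds {n : ℕ} (hn : 2 ≤ n) {α : ℝ}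
    (hα : (n : ℝ) * Real.sqrt n * α ≤ 1 / 6.1) {f : (Fin n → ℂ) → (Fin n → ℂ)}
    (hf : DifferentiableOn ℂ f (polydisk n)) (hJ : ∀ z ∈ polydisk n, jacobian f z ≠ 0)
    (hfα : schwarzianNorm f ≤ (α : EReal)) :
    ∃ c P : ℝ, (∀ t : ℝ, 0 ≤ t → c * (9 / 10 * t) + P + (9 / 10 * t) ^ 2 < 9 / 10 * (1 + t ^ 2)) ∧
      ∀ z ∈ polydisk n, ∀ ω > 0, (∀ i, ω ≤ 1 - ‖z i‖ ^ 2) →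
        (∀ k, ∑ i, ∑ j, ‖schwarzianDeriv f i j k z‖ ≤ c / ω) ∧
        ∑ i, ∑ j, ‖schwarzianPotential f i j z‖ ≤ P / ω ^ 2 := by
  have hα0 := nonneg_of_schwarzianNorm_le (by omega) hfα
  have h2 : √(2 : ℝ) ^ 2 = 2 := Real.sq_sqrt (by norm_num)
  have hnsq : √(n : ℝ) ^ 2 = n := Real.sq_sqrt (by positivity)
  have hα' : n ^ 3 * α ^ 2 ≤ (10 / 61) ^ 2 := by
    have h := pow_le_pow_left₀ (by positivity) hα 2
    rw [mul_pow, mul_pow, hnsq] at h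
    norm_num at h ⊢
    linarith
  -- The case `n = 2` is separate: the general entry bound would only give `P ≈ 0.94`, already above
  -- the barrier constant `9/10` at `t = 0`.
  rcases hn.eq_or_lt with rfl | hn3
  · refine ⟨2 * √2 * α, _, ?_, fun z hz ω hω hωz =>
      ⟨sum_norm_schwarzianDeriv_le_two hf hJ hfα hz hω hωz, sum_norm_schwarzianPotential_le le_rfl
        hf hJ (fun z hz => norm_schwarzianDeriv_le_two hf hJ hfα hz) hz hω hωz⟩⟩
    have h85 : √(8 / 5 : ℝ) ^ 2 = 8 / 5 := Real.sq_sqrt (by norm_num)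
    have hbsq : (√(8 / 5 : ℝ) * α) ^ 2 = 8 / 5 * α ^ 2 := by rw [mul_pow, h85]
    have hb0 : 0 ≤ √(8 / 5 : ℝ) * α := by positivity
    generalize √(8 / 5 : ℝ) * α = b at hbsq hb0 ⊢
    norm_num at hα'
    have hc : 2 * √2 * α ≤ 10 / 61 := by
      refine (pow_le_pow_iff_left₀ (by positivity) (by norm_num) two_ne_zero).1 ?_
      rw [mul_pow, mul_pow, h2]
      linarith
    -- Here `b² = (8/5) α² ≤ (1/5) (10/61)²`, as `8 α² ≤ (10/61)²`.
    have hb1 : b ≤ 7332 / 100000 := by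
      refine (pow_le_pow_iff_left₀ hb0 (by norm_num) two_ne_zero).1 ?_
      rw [hbsq]
      linarith
    intro t ht
    have hct := mul_le_mul_of_nonneg_right hc (show 0 ≤ 9 / 10 * t by positivity)
    norm_num
    -- The difference of the two sides is a quadratic in `t` with small positive minimum near `t =
    -- 0.82`.
    nlinarith [sq_nonneg (t - 82 / 100)]
  · refine ⟨(2 * n - 1) * (√2 * α), _, ?_, fun z hz ω hω hωz =>
      ⟨sum_norm_schwarzianDeriv_le (by omega) (differentiableOn_schwarzianDeriv
        (isOpen_polydisk n) hf hJ) (fun z hz => norm_schwarzianDeriv_le hf (by omega) hfα hz)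
        hz hω hωz, sum_norm_schwarzianPotential_le hn hf hJ
          (fun z hz => norm_schwarzianDeriv_le hf (by omega) hfα hz) hz hω hωz⟩⟩
    have hbsq : (√2 * α) ^ 2 = 2 * α ^ 2 := by rw [mul_pow, h2]
    have hb0 : 0 ≤ √2 * α := by positivity
    generalize √2 * α = b at hbsq hb0 ⊢
    have hn3' : (3 : ℝ) ≤ n := by exact_mod_cast hn3
    generalize (n : ℝ) = x at *
    -- For `x ≥ 3`, `(x b)² = 2 x² α² ≤ (2/3) x³ α² ≤ (2/3) (10/61)²`.
    have hx : x * b ≤ 134 / 1000 := by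
      refine (pow_le_pow_iff_left₀ (by positivity) (by norm_num) two_ne_zero).1 ?_
      rw [mul_pow, hbsq]
      have : 3 * (x ^ 2 * α ^ 2) ≤ x ^ 3 * α ^ 2 := by
        nlinarith [mul_nonneg (sq_nonneg x) (sq_nonneg α)]
      norm_num at hα'
      linarith
    -- The coefficient `11/3` is exact at `x = 3` for the part linear in `b`; after this only the
    -- product `x b` matters.
    have hP : (x ^ 2 * (x * b ^ 2 + b ^ 2 + 2 * b) + x * (4 / 3 * b - b ^ 2)) / (x - 1) ≤
        11 / 3 * (x * b) + 2 * (x * b) ^ 2 := by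
      rw [div_le_iff₀ (by linarith)]
      have h5 : 0 ≤ b * (x * (x - 3)) := mul_nonneg hb0 (mul_nonneg (by linarith) (by linarith))
      have h6 : 0 ≤ b ^ 2 * (x * (x * (x - 3) + 1)) :=
        mul_nonneg (sq_nonneg b) (mul_nonneg (by linarith) (by nlinarith))
      linarith
    have hxb : 0 ≤ x * b := mul_nonneg (by linarith) hb0
    have hP2 := mul_le_mul_of_nonneg_left hx hxb
    intro t ht
    have hc : (2 * x - 1) * b ≤ 268 / 1000 := by linarith
    have hct := mul_le_mul_of_nonneg_right hc (show 0 ≤ 9 / 10 * t by positivity)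
    linarith [sq_nonneg (t - 134 / 100)]

end Constants

/-! ### Comparison lemmas on an interval. -/

section Comparison

open Set

/-- A fencing theorem for sums of norms. -/
lemma sum_norm_le_of_deriv_boundary {m : ℕ} {r r' : ℝ → Fin m → ℂ} {B B' : ℝ → ℝ} {b : ℝ}
    (hr : ∀ t ∈ Icc 0 b, ∀ i, HasDerivAt (fun t => r t i) (r' t i) t)
    (h0 : ∑ i, ‖r 0 i‖ ≤ B 0) (hB : ∀ t ∈ Icc 0 b, HasDerivAt B (B' t) t)
    (bound : ∀ t ∈ Ico 0 b, ∑ i, ‖r t i‖ = B t → ∑ i, ‖r' t i‖ < B' t) :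
    ∀ t ∈ Icc 0 b, ∑ i, ‖r t i‖ ≤ B t := by
  -- The sum of norms is the `ℓ¹` norm of the vector, so the fencing theorem for normed spaces
  -- applies without differentiating a norm.
  have hd : ∀ t ∈ Icc 0 b, HasDerivAt (fun t => WithLp.toLp 1 (r t)) (WithLp.toLp 1 (r' t)) t :=
    fun t ht => (PiLp.hasFDerivAt_toLp (𝕜 := ℝ) 1 (r t)).comp_hasDerivAt t
      (hasDerivAt_pi.2 (hr t ht))
  intro t ht
  have h := image_norm_le_of_norm_deriv_right_lt_deriv_boundary'
    (f := fun t => WithLp.toLp 1 (r t)) (f' := fun t => WithLp.toLp 1 (r' t)) (a := 0) (b := b)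
    (B := B) (B' := B')
    (fun t ht => (hd t ht).continuousAt.continuousWithinAt)
    (fun t ht => (hd t (Ico_subset_Icc_self ht)).hasDerivWithinAt)
    (by rw [PiLp.norm_eq_of_L1]; exact h0)
    (fun t ht => (hB t ht).continuousAt.continuousWithinAt)
    (fun t ht => (hB t (Ico_subset_Icc_self ht)).hasDerivWithinAt)
    (fun t ht => by
      rw [PiLp.norm_eq_of_L1, PiLp.norm_eq_of_L1]
      exact bound t ht)
  have := h ht
  rwa [PiLp.norm_eq_of_L1] at this

/-- Two-sided growth bound for a function with bounded logarithmic derivative. -/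
lemma norm_exp_bounds_of_norm_deriv_le {g g' : ℝ → ℂ} {κ κ' : ℝ → ℝ} {b : ℝ} (hb : 0 ≤ b)
    (hgc : ContinuousOn g (Icc 0 b)) (hg : ∀ t ∈ Ioo 0 b, HasDerivAt g (g' t) t)
    (hκc : ContinuousOn κ (Icc 0 b)) (hκ : ∀ t ∈ Ioo 0 b, HasDerivAt κ (κ' t) t)
    (hle : ∀ t ∈ Ioo 0 b, ‖g' t‖ ≤ κ' t * ‖g t‖) :
    ‖g 0‖ * Real.exp (κ 0) ≤ ‖g b‖ * Real.exp (κ b) ∧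
      ‖g b‖ * Real.exp (-κ b) ≤ ‖g 0‖ * Real.exp (-κ 0) := by
  -- Monotonicity of `‖g‖² exp(±2κ)`. Squaring keeps the function differentiable where `g` vanishes,
  -- so no nonvanishing of `g` is needed.
  have hd : ∀ ε : ℝ, ∀ t ∈ Ioo 0 b, HasDerivAt (fun t => ‖g t‖ ^ 2 * Real.exp (2 * (ε * κ t)))
      (2 * (inner ℝ (g t) (g' t) + ε * κ' t * ‖g t‖ ^ 2) * Real.exp (2 * (ε * κ t))) t := by
    intro ε t ht
    have h1 : HasDerivAt (fun t => ‖g t‖ ^ 2) _ t := (hg t ht).norm_sq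
    have h2 := (((hκ t ht).const_mul ε).const_mul 2).exp
    refine (h1.fun_mul h2).congr_deriv ?_
    ring
  have hc : ∀ ε : ℝ, ContinuousOn (fun t => ‖g t‖ ^ 2 * Real.exp (2 * (ε * κ t))) (Icc 0 b) :=
    fun ε => (hgc.norm.pow 2).mul
      (Real.continuous_exp.comp_continuousOn ((hκc.const_smul ε).const_smul (2 : ℝ)))
  have hinner : ∀ t ∈ Ioo 0 b, |inner ℝ (g t) (g' t)| ≤ κ' t * ‖g t‖ ^ 2 := by
    intro t ht
    calc |inner ℝ (g t) (g' t)| ≤ ‖g t‖ * ‖g' t‖ := abs_real_inner_le_norm _ _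
      _ ≤ ‖g t‖ * (κ' t * ‖g t‖) := mul_le_mul_of_nonneg_left (hle t ht) (norm_nonneg _)
      _ = κ' t * ‖g t‖ ^ 2 := by ring
  have hsq : ∀ ε t : ℝ, ‖g t‖ ^ 2 * Real.exp (2 * (ε * κ t)) = (‖g t‖ * Real.exp (ε * κ t)) ^ 2 := by
    intro ε t
    rw [mul_pow, ← Real.exp_nat_mul]
    norm_num
  have hmono := monotoneOn_of_hasDerivWithinAt_nonneg (convex_Icc 0 b) (hc 1)
    (fun t ht => (hd 1 t (by rwa [interior_Icc] at ht)).hasDerivWithinAt) (fun t ht => by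
      rw [interior_Icc] at ht
      have := neg_le_of_abs_le (hinner t ht)
      exact mul_nonneg (mul_nonneg two_pos.le (by linarith)) (Real.exp_pos _).le)
  have hanti := antitoneOn_of_hasDerivWithinAt_nonpos (convex_Icc 0 b) (hc (-1))
    (fun t ht => (hd (-1) t (by rwa [interior_Icc] at ht)).hasDerivWithinAt) (fun t ht => by
      rw [interior_Icc] at ht
      have := le_of_abs_le (hinner t ht)
      exact mul_nonpos_of_nonpos_of_nonneg (by linarith) (Real.exp_pos _).le)
  have h1 := hmono (left_mem_Icc.2 hb) (right_mem_Icc.2 hb) hb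
  have h2 := hanti (left_mem_Icc.2 hb) (right_mem_Icc.2 hb) hb
  simp only [hsq] at h1 h2
  have h3 := le_of_abs_le (abs_le_of_sq_le_sq h1 (by positivity))
  have h4 := le_of_abs_le (abs_le_of_sq_le_sq h2 (by positivity))
  simp only [one_mul, neg_one_mul] at h3 h4
  exact ⟨h3, h4⟩

end Comparison

/-! ### The Möbius denominator and the Riccati system. -/

section Denominator

variable {n : ℕ} {f : (Fin n → ℂ) → (Fin n → ℂ)} {s : Set (Fin n → ℂ)} {z : Fin n → ℂ}
  {a : Fin n → ℂ}

/-- The denominator of the Möbius transformation, composed with `f`. -/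
def moebiusDenominator (a : Fin n → ℂ) (f : (Fin n → ℂ) → (Fin n → ℂ)) (z : Fin n → ℂ) : ℂ :=
  1 + ∑ j, a j * f z j

/-- The logarithmic derivative `∂ᵢ log u` of `u = J_g ^ (-1 / (n + 1))` for `g = moebius a ∘ f`. -/
def logDerivRoot (a : Fin n → ℂ) (f : (Fin n → ℂ) → (Fin n → ℂ)) (i : Fin n) (z : Fin n → ℂ) : ℂ :=
  partialDeriv i (moebiusDenominator a f) z / moebiusDenominator a f z + logDerivRootJacobian f i z

lemma differentiableOn_moebiusDenominator (hf : DifferentiableOn ℂ f s) :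
    DifferentiableOn ℂ (moebiusDenominator a f) s :=
  (differentiableOn_const 1).add (DifferentiableOn.fun_sum fun j _ =>
    (differentiableOn_component hf j).const_mul (a j))

lemma partialDeriv_moebiusDenominator (hf : DifferentiableAt ℂ f z) (i : Fin n) :
    partialDeriv i (moebiusDenominator a f) z =
      ∑ l, a l * partialDeriv i (fun w => f w l) z := by
  have hl : ∀ l, DifferentiableAt ℂ (fun w => f w l) z := fun l => differentiableAt_pi.1 hf l
  rw [show moebiusDenominator a f = fun w => 1 + ∑ j, a j * f w j from rfl,
    partialDeriv_add (differentiableAt_const _)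
      (DifferentiableAt.fun_sum fun j _ => (hl j).const_mul (a j)),
    partialDeriv_const, zero_add, partialDeriv_sum fun j _ => (hl j).const_mul (a j)]
  exact Finset.sum_congr rfl fun l _ => partialDeriv_const_mul _ (hl l) i

/-- `D` is affine in `f`, so its second derivatives are `∑ₖ Γᵏⱼᵢ ∂ₖD`; writing `Γ` in terms of `S`
produces the last two terms. -/
lemma partialDeriv_partialDeriv_moebiusDenominator (hs : IsOpen s) (hf : DifferentiableOn ℂ f s)
    (hJ : ∀ z ∈ s, jacobian f z ≠ 0) (hz : z ∈ s) (i j : Fin n) :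
    partialDeriv j (partialDeriv i (moebiusDenominator a f)) z =
      ∑ k, schwarzianDeriv f j i k z * partialDeriv k (moebiusDenominator a f) z
      - partialDeriv j (moebiusDenominator a f) z * logDerivRootJacobian f i z
      - partialDeriv i (moebiusDenominator a f) z * logDerivRootJacobian f j z := by
  have hd : ∀ l, DifferentiableAt ℂ (partialDeriv i (fun w => f w l)) z := fun l =>
    ((differentiableOn_component hf l).partialDeriv hs i).differentiableAt (hs.mem_nhds hz)
  have hev : partialDeriv i (moebiusDenominator a f) =ᶠ[nhds z] fun w =>
      ∑ l, a l * partialDeriv i (fun w => f w l) w :=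
    Filter.eventually_of_mem (hs.mem_nhds hz) fun w hw =>
      partialDeriv_moebiusDenominator (hf.differentiableAt (hs.mem_nhds hw)) i
  have h1 : partialDeriv j (partialDeriv i (moebiusDenominator a f)) z =
      ∑ k, christoffel f j i k z * partialDeriv k (moebiusDenominator a f) z := by
    rw [partialDeriv_congr hev, partialDeriv_sum fun l _ => (hd l).const_mul (a l)]
    simp only [fun l => partialDeriv_const_mul (a l) (hd l) j,
      ← sum_partialDeriv_mul_christoffel (hJ z hz), Finset.mul_sum,
      partialDeriv_moebiusDenominator (a := a) (hf.differentiableAt (hs.mem_nhds hz))]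
    rw [Finset.sum_comm]
    exact Finset.sum_congr rfl fun k _ => Finset.sum_congr rfl fun l _ => by ring
  rw [h1]
  simp only [schwarzianDeriv_eq, add_mul, Finset.sum_add_distrib]
  simp
  ring

lemma differentiableAt_logDerivRoot (hs : IsOpen s) (hf : DifferentiableOn ℂ f s)
    (hJ : ∀ z ∈ s, jacobian f z ≠ 0) (hz : z ∈ s) (hD : moebiusDenominator a f z ≠ 0) (i : Fin n) :
    DifferentiableAt ℂ (logDerivRoot a f i) z := by
  have hDd := differentiableOn_moebiusDenominator (a := a) hf
  have h1 := (hDd.partialDeriv hs i).differentiableAt (hs.mem_nhds hz)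
  have h2 := (differentiableOn_logDerivRootJacobian hs hf hJ i).differentiableAt (hs.mem_nhds hz)
  refine ((h1.fun_mul ((hDd.differentiableAt (hs.mem_nhds hz)).inv hD)).fun_add
    h2).congr_of_eventuallyEq (Filter.Eventually.of_forall fun w => ?_)
  rw [logDerivRoot, div_eq_mul_inv]
  rfl

/-- The Riccati system satisfied by the logarithmic derivatives. -/
theorem partialDeriv_logDerivRoot (hs : IsOpen s) (hf : DifferentiableOn ℂ f s)
    (hJ : ∀ z ∈ s, jacobian f z ≠ 0) (hz : z ∈ s) (hD : moebiusDenominator a f z ≠ 0)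
    (i j : Fin n) :
    partialDeriv j (logDerivRoot a f i) z =
      ∑ k, schwarzianDeriv f j i k z * logDerivRoot a f k z
        - logDerivRoot a f i z * logDerivRoot a f j z + schwarzianPotential f j i z := by
  have hDo := differentiableOn_moebiusDenominator (a := a) hf
  have hDd := hDo.differentiableAt (hs.mem_nhds hz)
  have h1 := (hDo.partialDeriv hs i).differentiableAt (hs.mem_nhds hz)
  have h2 := (differentiableOn_logDerivRootJacobian hs hf hJ i).differentiableAt (hs.mem_nhds hz)
  have h3 : DifferentiableAt ℂ (fun w => partialDeriv i (moebiusDenominator a f) w /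
      moebiusDenominator a f w) z :=
    (h1.fun_mul (hDd.inv hD)).congr_of_eventuallyEq
      (Filter.Eventually.of_forall fun w => div_eq_mul_inv _ _)
  rw [show logDerivRoot a f i = fun w => partialDeriv i (moebiusDenominator a f) w /
      moebiusDenominator a f w + logDerivRootJacobian f i w from rfl,
    partialDeriv_add h3 h2, partialDeriv_div h1 hDd hD,
    partialDeriv_partialDeriv_moebiusDenominator hs hf hJ hz, schwarzianPotential]
  have hsum : ∑ k, schwarzianDeriv f j i k z * logDerivRoot a f k z =
      (∑ k, schwarzianDeriv f j i k z * partialDeriv k (moebiusDenominator a f) z) /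
        moebiusDenominator a f z +
      ∑ k, schwarzianDeriv f j i k z * logDerivRootJacobian f k z := by
    rw [Finset.sum_div, ← Finset.sum_add_distrib]
    exact Finset.sum_congr rfl fun k _ => by rw [logDerivRoot]; ring
  rw [hsum]
  simp only [logDerivRoot]
  field_simp
  ring

end Denominator

/-! ### The Riccati comparison along rays and nonvanishing of the denominator. -/

section Rays

open Set

variable {n : ℕ} {f : (Fin n → ℂ) → (Fin n → ℂ)} {z ζ a : Fin n → ℂ} {c P : ℝ}

/-- The Riccati estimate for the sum of the weighted logarithmic derivatives. -/
lemma sum_norm_riccati_le {C K : ℝ}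
    (hf : DifferentiableOn ℂ f (polydisk n)) (hJ : ∀ z ∈ polydisk n, jacobian f z ≠ 0)
    (hz : z ∈ polydisk n) (hD : moebiusDenominator a f z ≠ 0) (hζ : ∀ i, ‖ζ i‖ ≤ 1)
    (hzero : ∀ i j k, k ≠ i → k ≠ j → schwarzianDeriv f i j k z = 0)
    (hC : ∀ k, ∑ i, ∑ j, ‖schwarzianDeriv f i j k z‖ ≤ C)
    (hK : ∑ i, ∑ j, ‖schwarzianPotential f i j z‖ ≤ K) :
    ∑ i, ‖ζ i * ∑ j, ζ j * partialDeriv j (logDerivRoot a f i) z‖ ≤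
      C * (∑ i, ‖ζ i * logDerivRoot a f i z‖) + K + (∑ i, ‖ζ i * logDerivRoot a f i z‖) ^ 2 := by
  set r : Fin n → ℝ := fun i => ‖ζ i * logDerivRoot a f i z‖ with hr
  -- A surviving entry has `k ∈ {i, j}`: one of the weights `ζᵢ, ζⱼ` becomes the `ζₖ` inside `r k`,
  -- and the other is at most `1`. Hence the estimate closes in terms of `∑ r k`.
  have hS : ∀ i j k, ‖ζ i‖ * ‖ζ j‖ * (‖schwarzianDeriv f j i k z‖ * ‖logDerivRoot a f k z‖) ≤
      ‖schwarzianDeriv f j i k z‖ * r k := by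
    intro i j k
    have h0 : 0 ≤ ‖schwarzianDeriv f j i k z‖ * ‖logDerivRoot a f k z‖ := by positivity
    simp only [hr, norm_mul]
    by_cases hkj : k = j
    · subst hkj
      nlinarith [mul_nonneg (norm_nonneg (ζ k)) h0, hζ i, mul_le_mul_of_nonneg_right (hζ i)
        (mul_nonneg (norm_nonneg (ζ k)) h0)]
    · by_cases hki : k = i
      · subst hki
        nlinarith [mul_nonneg (norm_nonneg (ζ k)) h0, hζ j, mul_le_mul_of_nonneg_right (hζ j)
          (mul_nonneg (norm_nonneg (ζ k)) h0)]
      · simp [hzero j i k hkj hki]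
  have hterm : ∀ i j, ‖ζ i * (ζ j * partialDeriv j (logDerivRoot a f i) z)‖ ≤
      ∑ k, ‖schwarzianDeriv f j i k z‖ * r k + r i * r j + ‖schwarzianPotential f j i z‖ := by
    intro i j
    rw [partialDeriv_logDerivRoot (isOpen_polydisk n) hf hJ hz hD, norm_mul, norm_mul, ← mul_assoc]
    have h1 : ‖∑ k, schwarzianDeriv f j i k z * logDerivRoot a f k z
        - logDerivRoot a f i z * logDerivRoot a f j z + schwarzianPotential f j i z‖ ≤
        ∑ k, ‖schwarzianDeriv f j i k z‖ * ‖logDerivRoot a f k z‖ +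
          ‖logDerivRoot a f i z‖ * ‖logDerivRoot a f j z‖ + ‖schwarzianPotential f j i z‖ := by
      refine (norm_add_le _ _).trans (add_le_add_left ((norm_sub_le _ _).trans (add_le_add
        ((norm_sum_le _ _).trans_eq ?_) (norm_mul_le _ _))) _)
      exact Finset.sum_congr rfl fun k _ => norm_mul _ _
    refine (mul_le_mul_of_nonneg_left h1 (by positivity)).trans ?_
    rw [mul_add, mul_add, Finset.mul_sum]
    refine add_le_add (add_le_add (Finset.sum_le_sum fun k _ => hS i j k) (le_of_eq ?_)) ?_
    · simp only [hr, norm_mul]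
      ring
    · exact mul_le_of_le_one_left (norm_nonneg _)
        (mul_le_one₀ (hζ i) (norm_nonneg _) (hζ j))
  calc ∑ i, ‖ζ i * ∑ j, ζ j * partialDeriv j (logDerivRoot a f i) z‖
      ≤ ∑ i, ∑ j, (∑ k, ‖schwarzianDeriv f j i k z‖ * r k + r i * r j
          + ‖schwarzianPotential f j i z‖) := by
        refine Finset.sum_le_sum fun i _ => ?_
        rw [Finset.mul_sum]
        exact (norm_sum_le _ _).trans (Finset.sum_le_sum fun j _ => hterm i j)
    _ = ∑ k, (∑ i, ∑ j, ‖schwarzianDeriv f i j k z‖) * r k + (∑ i, r i) ^ 2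
          + ∑ i, ∑ j, ‖schwarzianPotential f i j z‖ := by
        simp only [Finset.sum_add_distrib]
        congr 1
        · congr 1
          · simp only [Finset.sum_mul]
            rw [Finset.sum_comm]
            rw [Finset.sum_comm (s := Finset.univ (α := Fin n)) (t := Finset.univ (α := Fin n))
              (f := fun k i => ∑ j, ‖schwarzianDeriv f i j k z‖ * r k)]
            exact Finset.sum_congr rfl fun i _ => Finset.sum_comm
          · rw [sq, Finset.sum_mul_sum]
        · exact Finset.sum_comm
    _ ≤ ∑ k, C * r k + (∑ i, r i) ^ 2 + K := by
        refine add_le_add (add_le_add_left (Finset.sum_le_sum fun k _ => ?_) _) hK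
        exact mul_le_mul_of_nonneg_right (hC k) (norm_nonneg _)
    _ = _ := by
        rw [← Finset.mul_sum]
        ring

lemma smul_mem_polydisk {t : ℝ} (h0 : 0 ≤ t) (h1 : t < 1) (hζ : ∀ i, ‖ζ i‖ ≤ 1) :
    t • ζ ∈ polydisk n := by
  intro i
  rw [Pi.smul_apply, norm_smul, Real.norm_of_nonneg h0]
  exact (mul_le_of_le_one_right h0 (hζ i)).trans_lt h1

lemma one_sub_sq_le_one_sub_norm_sq {t : ℝ} (h0 : 0 ≤ t) (hζ : ∀ i, ‖ζ i‖ ≤ 1) (i : Fin n) :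
    1 - t ^ 2 ≤ 1 - ‖(t • ζ) i‖ ^ 2 := by
  rw [Pi.smul_apply, norm_smul, Real.norm_of_nonneg h0]
  have : t * ‖ζ i‖ ≤ t := mul_le_of_le_one_right h0 (hζ i)
  have := pow_le_pow_left₀ (mul_nonneg h0 (norm_nonneg _)) this 2
  linarith

lemma hasDerivAt_mul_div_one_sub_sq (L : ℝ) {t : ℝ} (ht : 1 - t ^ 2 ≠ 0) :
    HasDerivAt (fun t : ℝ => L * t / (1 - t ^ 2)) (L * (1 + t ^ 2) / (1 - t ^ 2) ^ 2) t := by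
  have h1 : HasDerivAt (fun t : ℝ => L * t) L t := by
    simpa using (hasDerivAt_id t).const_mul L
  have h2 : HasDerivAt (fun t : ℝ => 1 - t ^ 2) (-(2 * t)) t := by
    simpa using (hasDerivAt_pow 2 t).const_sub 1
  refine (h1.fun_div h2 ht).congr_deriv ?_
  ring

/-- Bound on the logarithmic derivatives along a ray on which the denominator has no zero. -/
lemma sum_norm_logDerivRoot_ray_le
    (hf : DifferentiableOn ℂ f (polydisk n)) (hJ : ∀ z ∈ polydisk n, jacobian f z ≠ 0)
    (hzero : ∀ z ∈ polydisk n, ∀ i j k, k ≠ i → k ≠ j → schwarzianDeriv f i j k z = 0)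
    (hcP : ∀ t : ℝ, 0 ≤ t → c * (9 / 10 * t) + P + (9 / 10 * t) ^ 2 < 9 / 10 * (1 + t ^ 2))
    (hbound : ∀ z ∈ polydisk n, ∀ ω > 0, (∀ i, ω ≤ 1 - ‖z i‖ ^ 2) →
        (∀ k, ∑ i, ∑ j, ‖schwarzianDeriv f i j k z‖ ≤ c / ω) ∧
        ∑ i, ∑ j, ‖schwarzianPotential f i j z‖ ≤ P / ω ^ 2)
    (h0 : ∀ i, logDerivRoot a f i 0 = 0) (hζ : ∀ i, ‖ζ i‖ ≤ 1) {b : ℝ} (hb1 : b < 1)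
    (hD : ∀ t ∈ Icc 0 b, moebiusDenominator a f (t • ζ) ≠ 0) :
    ∀ t ∈ Icc 0 b, ∑ i, ‖ζ i * logDerivRoot a f i (t • ζ)‖ ≤ 9 / 10 * t / (1 - t ^ 2) := by
  have hmem : ∀ t ∈ Icc 0 b, t • ζ ∈ polydisk n := fun t ht =>
    smul_mem_polydisk ht.1 (ht.2.trans_lt hb1) hζ
  have hpos : ∀ t ∈ Icc 0 b, 0 < 1 - t ^ 2 := fun t ht =>
    one_sub_sq_pos ht.1 (ht.2.trans_lt hb1)
  refine sum_norm_le_of_deriv_boundary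
    (r := fun t i => ζ i * logDerivRoot a f i (t • ζ))
    (r' := fun t i => ζ i * ∑ j, ζ j * partialDeriv j (logDerivRoot a f i) (t • ζ))
    (B' := fun t => 9 / 10 * (1 + t ^ 2) / (1 - t ^ 2) ^ 2)
    (fun t ht i => (hasDerivAt_ray (differentiableAt_logDerivRoot (isOpen_polydisk n) hf hJ
      (hmem t ht) (hD t ht) i)).const_mul _) (by simp [h0])
    (fun t ht => hasDerivAt_mul_div_one_sub_sq _ (hpos t ht).ne') (fun t ht heq => ?_)
  have ht' := Ico_subset_Icc_self ht
  have hω := hpos t ht'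
  obtain ⟨hC, hK⟩ := hbound _ (hmem t ht') _ hω (one_sub_sq_le_one_sub_norm_sq ht.1 hζ)
  refine (sum_norm_riccati_le hf hJ (hmem t ht') (hD t ht') hζ (hzero _ (hmem t ht'))
    hC hK).trans_lt ?_
  rw [heq]
  -- At a contact time the sum equals the barrier, so the estimate becomes the scalar inequality
  -- `hcP` divided by `(1 - t²)²`.
  have : c / (1 - t ^ 2) * (9 / 10 * t / (1 - t ^ 2)) + P / (1 - t ^ 2) ^ 2 +
      (9 / 10 * t / (1 - t ^ 2)) ^ 2 =
      (c * (9 / 10 * t) + P + (9 / 10 * t) ^ 2) / (1 - t ^ 2) ^ 2 := by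
    field_simp
  rw [this]
  exact div_lt_div_of_pos_right (hcP t ht.1) (by positivity)

/-- The denominator has no zero on a ray. -/
lemma moebiusDenominator_ray_ne_zero
    (hf : DifferentiableOn ℂ f (polydisk n)) (hJ : ∀ z ∈ polydisk n, jacobian f z ≠ 0)
    (hzero : ∀ z ∈ polydisk n, ∀ i j k, k ≠ i → k ≠ j → schwarzianDeriv f i j k z = 0)
    (hcP : ∀ t : ℝ, 0 ≤ t → c * (9 / 10 * t) + P + (9 / 10 * t) ^ 2 < 9 / 10 * (1 + t ^ 2))
    (hbound : ∀ z ∈ polydisk n, ∀ ω > 0, (∀ i, ω ≤ 1 - ‖z i‖ ^ 2) →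
        (∀ k, ∑ i, ∑ j, ‖schwarzianDeriv f i j k z‖ ≤ c / ω) ∧
        ∑ i, ∑ j, ‖schwarzianPotential f i j z‖ ≤ P / ω ^ 2)
    (h0 : ∀ i, logDerivRoot a f i 0 = 0) (hf0 : f 0 = 0) (hζ : ∀ i, ‖ζ i‖ ≤ 1) {b : ℝ}
    (hb0 : 0 ≤ b) (hb1 : b < 1) : moebiusDenominator a f (b • ζ) ≠ 0 := by
  intro hzb
  have hmem : ∀ t ∈ Icc 0 b, t • ζ ∈ polydisk n := fun t ht =>
    smul_mem_polydisk ht.1 (ht.2.trans_lt hb1) hζ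
  have hopen := isOpen_polydisk n
  have hgd : ∀ t ∈ Icc 0 b, HasDerivAt (fun t : ℝ => moebiusDenominator a f (t • ζ))
      (∑ j, ζ j * partialDeriv j (moebiusDenominator a f) (t • ζ)) t := fun t ht =>
    hasDerivAt_ray ((differentiableOn_moebiusDenominator hf).differentiableAt
      (hopen.mem_nhds (hmem t ht)))
  have hgc : ContinuousOn (fun t : ℝ => moebiusDenominator a f (t • ζ)) (Icc 0 b) :=
    fun t ht => (hgd t ht).continuousAt.continuousWithinAt
  -- If `D` vanishes on the segment there is a first zero `T`; before it the Riccati estimate is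
  -- available.
  set Z := Icc 0 b ∩ (fun t : ℝ => moebiusDenominator a f (t • ζ)) ⁻¹' {0} with hZ
  have hZc : IsClosed Z := hgc.preimage_isClosed_of_isClosed isClosed_Icc isClosed_singleton
  have hZne : Z.Nonempty := ⟨b, right_mem_Icc.2 hb0, hzb⟩
  have hZb : BddBelow Z := ⟨0, fun t ht => ht.1.1⟩
  obtain ⟨hT, hgT⟩ : sInf Z ∈ Z := hZc.csInf_mem hZne hZb
  set T := sInf Z with hTdef
  have hTb : Icc 0 T ⊆ Icc 0 b := Icc_subset_Icc_right hT.2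
  have hD : ∀ t ∈ Ico 0 T, moebiusDenominator a f (t • ζ) ≠ 0 := fun t ht h =>
    (csInf_le hZb ⟨⟨ht.1, ht.2.le.trans hT.2⟩, h⟩).not_gt ht.2
  have hV : ContinuousOn (fun t : ℝ => ∑ j, ζ j * logDerivRootJacobian f j (t • ζ)) (Icc 0 T) :=
    fun t ht => (ContinuousAt.continuousWithinAt (tendsto_finsetSum _ fun j _ =>
      (hasDerivAt_ray ((differentiableOn_logDerivRootJacobian hopen hf hJ j).differentiableAt
        (hopen.mem_nhds (hmem t (hTb ht))))).continuousAt.const_mul (ζ j)))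
  obtain ⟨C, hC⟩ := isCompact_Icc.exists_bound_of_continuousOn hV
  have hpos : 0 < 1 - T ^ 2 := one_sub_sq_pos hT.1 (hT.2.trans_lt hb1)
  -- `D' = (∑ ζⱼ qⱼ - ∑ ζⱼ vⱼ) D`, where `v` is the logarithmic derivative of `J_f^(-1/(n+1))`. The
  -- first sum is bounded by the barrier uniformly up to `T`, the second by compactness, so `|D|`
  -- cannot decay from `1` to `0` in finite time.
  have hle : ∀ t ∈ Ioo 0 T, ‖∑ j, ζ j * partialDeriv j (moebiusDenominator a f) (t • ζ)‖ ≤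
      (1 / (1 - T ^ 2) + C) * ‖moebiusDenominator a f (t • ζ)‖ := by
    intro t ht
    have htI : t ∈ Ico 0 T := ⟨ht.1.le, ht.2⟩
    have hDt := hD t htI
    have hray := sum_norm_logDerivRoot_ray_le hf hJ hzero hcP hbound h0 hζ
      (ht.2.trans (hT.2.trans_lt hb1)) (fun x hx => hD x ⟨hx.1, hx.2.trans_lt ht.2⟩) t
      (right_mem_Icc.2 ht.1.le)
    have heq : ∑ j, ζ j * partialDeriv j (moebiusDenominator a f) (t • ζ) =
        (∑ j, ζ j * logDerivRoot a f j (t • ζ) - ∑ j, ζ j * logDerivRootJacobian f j (t • ζ)) *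
          moebiusDenominator a f (t • ζ) := by
      rw [← Finset.sum_sub_distrib, Finset.sum_mul]
      refine Finset.sum_congr rfl fun j _ => ?_
      rw [logDerivRoot]
      field_simp
      ring
    rw [heq, norm_mul]
    refine mul_le_mul_of_nonneg_right ((norm_sub_le _ _).trans (add_le_add
      ((norm_sum_le _ _).trans (hray.trans ?_)) (hC t ⟨ht.1.le, ht.2.le⟩))) (norm_nonneg _)
    have hT1 := hT.2.trans_lt hb1
    exact div_le_div₀ zero_le_one (by linarith [ht.2]) hpos
      (by nlinarith [ht.1, ht.2])
  have hkey := norm_exp_bounds_of_norm_deriv_le hT.1 (hgc.mono hTb)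
    (fun t ht => hgd t (hTb (Ioo_subset_Icc_self ht)))
    (κ := fun t => (1 / (1 - T ^ 2) + C) * t) (by fun_prop)
    (fun t _ => by
      simpa only [mul_one] using (hasDerivAt_id' t).const_mul (1 / (1 - T ^ 2) + C)) hle
  have hg0 : moebiusDenominator a f ((0 : ℝ) • ζ) = 1 := by simp [moebiusDenominator, hf0]
  have hgT' : moebiusDenominator a f (T • ζ) = 0 := hgT
  have h := hkey.1
  simp only [hg0, hgT'] at h
  norm_num at h

end Rays

/-! ### The Jacobian of the normalized mapping and the conclusion. -/

section Main

open Set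

variable {n : ℕ} {f : (Fin n → ℂ) → (Fin n → ℂ)} {z ζ a : Fin n → ℂ}

/-- The Jacobian of a locally biholomorphic mapping has no zero. -/
lemma IsLocallyBiholomorphicOn.jacobian_ne_zero {Ω : Set (Fin n → ℂ)}
    (hf : IsLocallyBiholomorphicOn f Ω) (hz : z ∈ Ω) : jacobian f z ≠ 0 := by
  obtain ⟨hd, hloc⟩ := hf
  obtain ⟨U, hU, hzU, hUΩ, hfU, h, hh, hinv⟩ := hloc z hz
  have hfz : DifferentiableAt ℂ f z := (hd.mono hUΩ).differentiableAt (hU.mem_nhds hzU)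
  have hhz : DifferentiableAt ℂ h (f z) :=
    hh.differentiableAt (hfU.mem_nhds (mem_image_of_mem f hzU))
  have hcomp : (fderiv ℂ h (f z)).comp (fderiv ℂ f z) = ContinuousLinearMap.id ℂ (Fin n → ℂ) := by
    have h1 := hhz.hasFDerivAt.comp z hfz.hasFDerivAt
    have h2 : h ∘ f =ᶠ[nhds z] id :=
      Filter.eventually_of_mem (hU.mem_nhds hzU) fun w hw => hinv hw
    exact (h1.congr_of_eventuallyEq h2.symm).unique (hasFDerivAt_id z)
  have hmat : LinearMap.toMatrix' (fderiv ℂ f z : (Fin n → ℂ) →ₗ[ℂ] (Fin n → ℂ)) =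
      jacobianMatrix f z := by
    ext i j
    rw [LinearMap.toMatrix'_apply, jacobianMatrix, Matrix.of_apply, partialDeriv, fderiv_apply hfz]
    simp [Pi.single]
  have hmul : LinearMap.toMatrix' (fderiv ℂ h (f z) : (Fin n → ℂ) →ₗ[ℂ] (Fin n → ℂ)) *
      jacobianMatrix f z = 1 := by
    have hid : (fderiv ℂ h (f z) : (Fin n → ℂ) →ₗ[ℂ] (Fin n → ℂ)) ∘ₗ
        (fderiv ℂ f z : (Fin n → ℂ) →ₗ[ℂ] (Fin n → ℂ)) = LinearMap.id :=
      LinearMap.ext fun v => DFunLike.congr_fun hcomp v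
    rw [← hmat, ← LinearMap.toMatrix'_comp, hid, LinearMap.toMatrix'_id]
  intro h0
  have := congrArg Matrix.det hmul
  rw [Matrix.det_mul, show (jacobianMatrix f z).det = 0 from h0] at this
  simp at this

/-- The Jacobian of the composition with a Möbius transformation. -/
lemma jacobian_moebius_comp {s : Set (Fin n → ℂ)} (hs : IsOpen s) (hf : DifferentiableOn ℂ f s)
    (hz : z ∈ s) (hD : moebiusDenominator a f z ≠ 0) :
    jacobian (fun w => moebius a (f w)) z = jacobian f z / moebiusDenominator a f z ^ (n + 1) := by
  have hfz := hf.differentiableAt (hs.mem_nhds hz)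
  set d := moebiusDenominator a f z with hd
  -- The derivative of the Möbius map is `d⁻¹` times a rank one perturbation of the identity with
  -- determinant `d⁻¹`; together they give `d^(-(n+1))`.
  have hM : jacobianMatrix (fun w => moebius a (f w)) z =
      d⁻¹ • ((1 + Matrix.replicateCol Unit (fun i => -d⁻¹ * f z i) * Matrix.replicateRow Unit a) *
        jacobianMatrix f z) := by
    ext i j
    have h1 := partialDeriv_div (differentiableAt_pi.1 hfz i)
      ((differentiableOn_moebiusDenominator (a := a) hf).differentiableAt (hs.mem_nhds hz)) hD j
    rw [partialDeriv_moebiusDenominator hfz] at h1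
    rw [Matrix.add_mul, Matrix.one_mul, Matrix.mul_assoc]
    simp only [jacobianMatrix, Matrix.of_apply, Matrix.smul_apply, Matrix.add_apply,
      Matrix.mul_apply, Matrix.replicateCol_apply, Matrix.replicateRow_apply, smul_eq_mul,
      Finset.univ_unique, Finset.sum_singleton]
    refine h1.trans ?_
    rw [← hd]
    field_simp
    ring
  have hda : 1 + ∑ i, a i * (-d⁻¹ * f z i) = d⁻¹ := by
    have : ∑ i, a i * (-d⁻¹ * f z i) = -d⁻¹ * ∑ i, a i * f z i := by
      rw [Finset.mul_sum]
      exact Finset.sum_congr rfl fun i _ => by ring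
    rw [this, show ∑ i, a i * f z i = d - 1 by rw [hd, moebiusDenominator]; ring]
    field_simp
    ring
  rw [jacobian, hM, Matrix.det_smul, Matrix.det_mul, Matrix.det_one_add_replicateCol_mul_replicateRow,
    dotProduct, hda, Fintype.card_fin, jacobian, pow_succ,
    inv_pow]
  field_simp

lemma hasDerivAt_neg_half_mul_log_one_sub_sq (k : ℝ) {t : ℝ} (ht : 0 < 1 - t ^ 2) :
    HasDerivAt (fun t : ℝ => -(k / 2) * Real.log (1 - t ^ 2)) (k * t / (1 - t ^ 2)) t := by
  have h2 : HasDerivAt (fun t : ℝ => 1 - t ^ 2) (-(2 * t)) t := by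
    simpa using (hasDerivAt_pow 2 t).const_sub 1
  refine ((h2.log ht.ne').const_mul (-(k / 2))).congr_deriv ?_
  field_simp

/-- Here `‖z‖` is the norm of `Fin n → ℂ`, which is `|z|_∞ = maxᵢ |zᵢ|`. -/
theorem corollary3p11 (n : ℕ) (hn : 2 ≤ n) (α : ℝ)
    (hα : (n : ℝ) * Real.sqrt n * α ≤ 1 / 6.1)
    (f : (Fin n → ℂ) → (Fin n → ℂ)) (hf : f ∈ normalizedFamily n α) :
    DifferentiableOn ℂ f (polydisk n) ∧
      ∀ z ∈ polydisk n,
        (1 - ‖z‖ ^ 2) ^ (Real.sqrt n * ((n : ℝ) + 1) / 2) ≤ ‖jacobian f z‖ ∧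
        ‖jacobian f z‖ ≤ 1 / (1 - ‖z‖ ^ 2) ^ (Real.sqrt n * ((n : ℝ) + 1) / 2) := by
  obtain ⟨g, ⟨hbi, hg0, hgI, hgα⟩, hfg⟩ := hf
  have hopen := isOpen_polydisk n
  have hg := hbi.1
  have hJ : ∀ z ∈ polydisk n, jacobian g z ≠ 0 := fun z hz => hbi.jacobian_ne_zero hz
  obtain ⟨c, P, hcP, hbound⟩ := exists_coefficient_bounds hn hα hg hJ hgα
  have hzero : ∀ z ∈ polydisk n, ∀ i j k, k ≠ i → k ≠ j → schwarzianDeriv g i j k z = 0 :=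
    fun z hz i j k hki hkj => schwarzianDeriv_eq_zero_of_ne
      (differentiableOn_schwarzianDeriv hopen hg hJ)
      (fun z hz => norm_schwarzianDeriv_le hg (by omega) hgα hz) hz hki hkj
  set a := normalizingVector g with ha
  have h0mem : (0 : Fin n → ℂ) ∈ polydisk n := fun i => by simp
  have hJ0 : jacobian g 0 = 1 := by rw [jacobian, hgI, Matrix.det_one]
  have hD0 : moebiusDenominator a g 0 = 1 := by simp [moebiusDenominator, hg0]
  -- This is the normalization: at the origin `∂ᵢD / D = aᵢ`, which cancels `-∂ᵢJ_g / (n + 1)`.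
  have hq0 : ∀ i, logDerivRoot a g i 0 = 0 := by
    intro i
    have h1 : ∑ l, a l * partialDeriv i (fun w => g w l) 0 = a i := by
      have h2 : ∀ l, partialDeriv i (fun w => g w l) 0 = (1 : Matrix (Fin n) (Fin n) ℂ) l i := by
        intro l
        rw [← hgI]
        rfl
      simp [h2, Matrix.one_apply]
    rw [logDerivRoot, partialDeriv_moebiusDenominator (hg.differentiableAt (hopen.mem_nhds h0mem)),
      h1, hD0, logDerivRootJacobian, partialLogJacobian, hJ0, ha, normalizingVector]
    ring
  have hpolar : ∀ z ∈ polydisk n, ∃ ζ : Fin n → ℂ, (∀ i, ‖ζ i‖ ≤ 1) ∧ ‖z‖ • ζ = z ∧ ‖z‖ < 1 := by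
    intro z hz
    refine ⟨‖z‖⁻¹ • z, fun i => ?_, ?_, (pi_norm_lt_iff one_pos).2 hz⟩
    · rw [Pi.smul_apply, norm_smul, norm_inv, norm_norm]
      exact inv_mul_le_one_of_le₀ (norm_le_pi_norm z i) (norm_nonneg z)
    · rcases eq_or_ne z 0 with rfl | h
      · simp
      · rw [smul_smul, mul_inv_cancel₀ (norm_ne_zero_iff.2 h), one_smul]
  have hDray : ∀ ζ : Fin n → ℂ, (∀ i, ‖ζ i‖ ≤ 1) → ∀ b : ℝ, 0 ≤ b → b < 1 →
      moebiusDenominator a g (b • ζ) ≠ 0 := fun ζ hζ b hb0 hb1 =>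
    moebiusDenominator_ray_ne_zero hg hJ hzero hcP hbound hq0 hg0 hζ hb0 hb1
  have hD : ∀ z ∈ polydisk n, moebiusDenominator a g z ≠ 0 := by
    intro z hz
    obtain ⟨ζ, hζ, hzζ, hz1⟩ := hpolar z hz
    rw [← hzζ]
    exact hDray ζ hζ _ (norm_nonneg z) hz1
  refine ⟨?_, fun z hz => ?_⟩
  · refine DifferentiableOn.congr (f := fun z => moebius a (g z)) ?_ hfg
    refine fun z hz => differentiableWithinAt_pi.2 fun i => ?_
    have h := (differentiableOn_component hg i z hz).fun_mul
      ((differentiableOn_moebiusDenominator hg z hz).fun_inv (hD z hz))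
    exact h.congr (fun w _ => div_eq_mul_inv _ _) (div_eq_mul_inv _ _)
  · obtain ⟨ζ, hζ, hzζ, hz1⟩ := hpolar z hz
    set b := ‖z‖ with hb
    have hb0 : 0 ≤ b := norm_nonneg z
    set k : ℝ := Real.sqrt n * ((n : ℝ) + 1) with hk
    have hjac : jacobian f z = jacobian g z / moebiusDenominator a g z ^ (n + 1) := by
      rw [← jacobian_moebius_comp hopen hg hz (hD z hz), jacobian, jacobian]
      congr 1
      ext i j
      refine partialDeriv_congr ?_ j
      filter_upwards [hopen.mem_nhds hz] with w hw
      rw [hfg hw]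
    have hmem : ∀ t ∈ Icc 0 b, t • ζ ∈ polydisk n := fun t ht =>
      smul_mem_polydisk ht.1 (ht.2.trans_lt hz1) hζ
    have hpos : ∀ t ∈ Icc 0 b, 0 < 1 - t ^ 2 := fun t ht =>
      one_sub_sq_pos ht.1 (ht.2.trans_lt hz1)
    have hDI : ∀ t ∈ Icc 0 b, moebiusDenominator a g (t • ζ) ≠ 0 := fun t ht => hD _ (hmem t ht)
    set G : ℝ → ℂ := fun t => jacobian g (t • ζ) / moebiusDenominator a g (t • ζ) ^ (n + 1) with hG
    have hGd : ∀ t ∈ Icc 0 b, HasDerivAt G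
        (-((n : ℂ) + 1) * (∑ j, ζ j * logDerivRoot a g j (t • ζ)) * G t) t := by
      intro t ht
      have h1 := hasDerivAt_ray ((differentiableOn_jacobian hopen hg).differentiableAt
        (hopen.mem_nhds (hmem t ht)))
      have h2 := hasDerivAt_ray ((differentiableOn_moebiusDenominator (a := a) hg).differentiableAt
        (hopen.mem_nhds (hmem t ht)))
      refine (h1.fun_div (h2.fun_pow (n + 1)) (pow_ne_zero _ (hDI t ht))).congr_deriv ?_
      have h3 : ((n : ℂ) + 1) ≠ 0 := Nat.cast_add_one_ne_zero n
      have h4 := hDI t ht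
      have h5 := hJ _ (hmem t ht)
      have h6 : ∑ j, ζ j * logDerivRoot a g j (t • ζ) =
          (∑ j, ζ j * partialDeriv j (moebiusDenominator a g) (t • ζ)) /
            moebiusDenominator a g (t • ζ) -
          (∑ j, ζ j * partialDeriv j (jacobian g) (t • ζ)) /
            (((n : ℂ) + 1) * jacobian g (t • ζ)) := by
        rw [Finset.sum_div, Finset.sum_div, ← Finset.sum_sub_distrib]
        refine Finset.sum_congr rfl fun j _ => ?_
        rw [logDerivRoot, logDerivRootJacobian, partialLogJacobian]
        field_simp
        ring
      rw [h6, hG]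
      push_cast
      field_simp
      ring
    have hray := sum_norm_logDerivRoot_ray_le hg hJ hzero hcP hbound hq0 hζ hz1 hDI
    -- The barrier yields the exponent with `9/10` in place of `√n`; only `9/10 ≤ √n` is needed.
    have hsqrt : 1 ≤ Real.sqrt n := by
      rw [Real.one_le_sqrt]
      exact_mod_cast (by omega : 1 ≤ n)
    have hkey := norm_exp_bounds_of_norm_deriv_le hb0
      (fun t ht => (hGd t ht).continuousAt.continuousWithinAt)
      (fun t ht => hGd t (Ioo_subset_Icc_self ht))
      -- Chosen so that `exp (-κ t) = (1 - t²)^(k/2)` and `κ 0 = 0`.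
      (κ := fun t => -(k / 2) * Real.log (1 - t ^ 2)) (κ' := fun t => k * t / (1 - t ^ 2))
      (fun t ht => (hasDerivAt_neg_half_mul_log_one_sub_sq k
        (hpos t ht)).continuousAt.continuousWithinAt)
      (fun t ht => hasDerivAt_neg_half_mul_log_one_sub_sq k (hpos t (Ioo_subset_Icc_self ht)))
      (fun t ht => by
        have ht' := Ioo_subset_Icc_self ht
        have hn1 : ‖-((n : ℂ) + 1)‖ = (n : ℝ) + 1 := by
          rw [norm_neg, ← Nat.cast_succ, Complex.norm_natCast, Nat.cast_succ]
        rw [norm_mul, norm_mul, hn1]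
        refine mul_le_mul_of_nonneg_right ?_ (norm_nonneg _)
        calc ((n : ℝ) + 1) * ‖∑ j, ζ j * logDerivRoot a g j (t • ζ)‖
            ≤ ((n : ℝ) + 1) * (9 / 10 * t / (1 - t ^ 2)) :=
              mul_le_mul_of_nonneg_left ((norm_sum_le _ _).trans (hray t ht')) (by positivity)
          _ ≤ k * t / (1 - t ^ 2) := by
              rw [← mul_div_assoc]
              refine div_le_div_of_nonneg_right ?_ (hpos t ht').le
              rw [← mul_assoc]
              refine mul_le_mul_of_nonneg_right ?_ ht.1.le
              rw [hk, mul_comm]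
              exact mul_le_mul_of_nonneg_right (by linarith) (by positivity))
    have hG0 : G 0 = 1 := by simp [hG, hJ0, hD0]
    have hGb : G b = jacobian f z := by rw [hjac, hG]; simp only [hzζ]
    have hb2 := hpos b (right_mem_Icc.2 hb0)
    have hexp : Real.exp (-(-(k / 2) * Real.log (1 - b ^ 2))) = (1 - b ^ 2) ^ (k / 2) := by
      rw [Real.rpow_def_of_pos hb2]
      congr 1
      ring
    simp only [hG0, hGb, hexp] at hkey
    have hpw : 0 < (1 - b ^ 2) ^ (k / 2) := Real.rpow_pos_of_pos hb2 _
    rw [← neg_neg (-(k / 2) * Real.log (1 - b ^ 2)), Real.exp_neg, hexp] at hkey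
    norm_num at hkey
    obtain ⟨hk1, hk2⟩ := hkey
    constructor
    · rw [← div_eq_mul_inv, le_div_iff₀ hpw, one_mul] at hk1
      exact hk1
    · rw [le_div_iff₀ hpw]
      exact hk2

end Main

end
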